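/- **Definitions.** An exact lcs structure on a manifold $M$ is a pair $(\lambda,\alpha)$ of smooth 1-forms with $\alpha$ closed and $\omega=d_\alpha\lambda:=d\lambda-\alpha\wedge\lambda$ non-degenerate. Its canonical distribution $\mathcal D$ is spanned at each point by the vectors $X_\lambda,X_\alpha$ with $\omega(X_\lambda,\cdot)=\lambda$ and $\omega(X_\alpha,\cdot)=\alpha$. A closed nodal Riemann surface $\Sigma$ is a closed Riemann surface $\widetilde\Sigma$ with finitely many pairwise disjoint pairs of distinct points; the two points of each pair are glued in $\Sigma$. A Reeb 2-curve in $(M,\lambda,\alpha)$ is a map $u:\Sigma\to M$ from a closed nodal Riemann surface whose normalization $\widetilde u:\widetilde\Sigma\to M$ is smooth, such that (1) $\widetilde u_*(T_z\widetilde\Sigma)=\mathcal D(\widetilde u(z))$ whenever $d\widetilde u(z)\neq0$ and $\dim\mathcal D(\widetilde u(z))=2$, and (2) $0\ne[u^*\alpha]\in H^1(\Sigma,\mathbb R)$. Let $T^2=\mathbb R^2/\mathbb Z^2$ with its standard flat metric $g_{st}$, and let $C$ be its unit cotangent bundle with the Liouville 1-form $\lambda$. An isometry $\phi$ of $(T^2,g_{st})$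 lifts to $\widetilde\phi:C\to C$, $\widetilde\phi(q,p)=(\phi(q),p\circ(d\phi_q)^{-1})$, which preserves $\lambda$. Let $M_{\widetilde\phi,1}=C\times\mathbb R/\big((x,\theta)\sim(\widetilde\phi(x),\theta+1)\big)$ be its mapping torus, with the 1-forms $\lambda_{\widetilde\phi}$ and $\alpha$ whose pullbacks to $C\times\mathbb R$ are the pullback of $\lambda$ and $d\theta$. **Theorem 2.10.** 1. Let $\phi$ be an isometry of $(T^2,g_{st})$ such that no iterate $\phi^n$, $n\ge1$, maps the image of a closed geodesic onto itself. Then $(M_{\widetilde\phi,1},\lambda_{\widetilde\phi},\alpha)$ is a closed (compact, Hausdorff, without boundary) connected exact lcs manifold, and it has no Reeb 2-curves. 2. If $1,a_1,a_2\in\mathbb R$ are linearly independent over $\mathbb Q$, then the rotation $x\mapsto x+(a_1,a_2)$ of $T^2$ is such an isometry. 3. Consequently the naive lcs analogue of the Weinstein conjecture, "every closed (non-empty, positive-dimensional) exact lcs manifold has a Reeb 2-curve", is false. -/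

import Mathlib

open Set Topology Manifold ContDiff Metric

noncomputable section

namespace LCS

universe v

/-! ### Quotient manifolds -/

section Quotient

variable {E : Type*} [NormedAddCommGroup E] [NormedSpace ℝ E]
  {H : Type*} [TopologicalSpace H] {I : ModelWithCorners ℝ E H}
  {X : Type*} [TopologicalSpace X] [ChartedSpace H X]
  {Y : Type*} [TopologicalSpace Y]

theorem localInverse_comp_eventually {p : X → Y} (hp : IsLocalHomeomorph p) {b x : X}
    (hx : p x ∈ (hp.localInverseAt b).source) {τ : X → X} (hτ : Continuous τ) (hpτ : p ∘ τ = p)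
    (hτx : τ x = hp.localInverseAt b (p x)) :
    ∀ᶠ w in 𝓝 x, hp.localInverseAt b (p w) = τ w := by
  have h1 : ∀ᶠ w in 𝓝 x, τ w ∈ (hp.localInverseAt b).target := by
    apply hτ.continuousAt.eventually_mem
    rw [hτx]
    exact (hp.localInverseAt b).open_target.mem_nhds ((hp.localInverseAt b).map_source hx)
  filter_upwards [h1] with w hw
  have h2 := (hp.localInverseAt b).right_inv hw
  rw [hp.localInverseAt_symm] at h2
  rwa [show p (τ w) = p w from congrFun hpτ w] at h2

/-- A local homeomorphism `p : X → Y` whose fibres are permuted transitively by smooth deck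
transformations makes `Y` a smooth manifold, with the local inverses of `p` followed by charts of
`X` as charts. -/
theorem isManifold_of_deck [IsManifold I ∞ X] {p : X → Y} (hp : IsLocalHomeomorph p)
    {g : Y → X} (hg : Function.RightInverse g p)
    (hdeck : ∀ x x', p x = p x' → ∃ τ : X → X, ContMDiff I I ∞ τ ∧ p ∘ τ = p ∧ τ x = x') :
    @IsManifold ℝ _ E _ _ H _ I ∞ Y _ (hp.chartedSpaceOfRightInverse hg) := by
  let _ := hp.chartedSpaceOfRightInverse (H := H) hg
  have key : ∀ a b : X, ContDiffOn ℝ ∞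
      (I ∘ (((hp.localInverseAt a).trans (chartAt H a)).symm.trans
        ((hp.localInverseAt b).trans (chartAt H b))) ∘ I.symm)
      (I.symm ⁻¹' (((hp.localInverseAt a).trans (chartAt H a)).symm.trans
        ((hp.localInverseAt b).trans (chartAt H b))).source ∩ range I) := by
    rintro a b z ⟨hz, hzr⟩
    simp only [mem_preimage, OpenPartialHomeomorph.trans_source,
      OpenPartialHomeomorph.symm_source, OpenPartialHomeomorph.trans_target,
      OpenPartialHomeomorph.coe_trans_symm, mem_inter_iff, Function.comp_apply,
      hp.localInverseAt_symm] at hz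
    obtain ⟨⟨hz1, -⟩, hz3, hz4⟩ := hz
    set x := (chartAt H a).symm (I.symm z) with hx
    obtain ⟨τ, hτ, hpτ, hτx⟩ := hdeck x (hp.localInverseAt b (p x))
      (hp.apply_localInverseAt_of_mem hz3).symm
    have hev := localInverse_comp_eventually hp hz3 hτ.continuous hpτ hτx
    have hzt : z ∈ (extChartAt I a).target := by
      rw [extChartAt_target]; exact ⟨hz1, hzr⟩
    have hs : ContMDiffWithinAt 𝓘(ℝ, E) I ∞ (extChartAt I a).symm (range I) z :=
      contMDiffWithinAt_extChartAt_symm_range a hzt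
    have hxz : (extChartAt I a).symm z = x := by simp [hx]
    have h1 : ContMDiffWithinAt 𝓘(ℝ, E) 𝓘(ℝ, E) ∞
        (extChartAt I b ∘ τ ∘ (extChartAt I a).symm) (range I) z := by
      have hb : ContMDiffAt I 𝓘(ℝ, E) ∞ (extChartAt I b) (τ x) :=
        contMDiffAt_extChartAt' (by rw [hτx]; exact hz4)
      have h2 : ContMDiffAt I 𝓘(ℝ, E) ∞ (extChartAt I b ∘ τ) x := hb.comp x (hτ x)
      rw [← hxz] at h2
      exact h2.comp_contMDiffWithinAt z hs
    have h2 := h1.contDiffWithinAt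
    have hcont : ContinuousWithinAt (extChartAt I a).symm (range I) z := hs.continuousWithinAt
    have hev' : ∀ᶠ w in 𝓝[range I] z,
        hp.localInverseAt b (p ((extChartAt I a).symm w)) = τ ((extChartAt I a).symm w) := by
      have hev2 : ∀ᶠ w in 𝓝 ((extChartAt I a).symm z), hp.localInverseAt b (p w) = τ w := by
        rw [hxz]; exact hev
      exact hcont.tendsto.eventually hev2
    refine (h2.congr_of_eventuallyEq ?_ ?_).mono inter_subset_right
    · filter_upwards [hev'] with w hw
      simp only [Function.comp_apply, OpenPartialHomeomorph.coe_trans,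
        OpenPartialHomeomorph.coe_trans_symm, hp.localInverseAt_symm, extChartAt_coe,
        extChartAt_coe_symm] at hw ⊢
      rw [hw]
    · simp only [Function.comp_apply, OpenPartialHomeomorph.coe_trans,
        OpenPartialHomeomorph.coe_trans_symm, hp.localInverseAt_symm, extChartAt_coe,
        extChartAt_coe_symm]
      rw [← hx, hτx]
  apply isManifold_of_contDiffOn
  rintro _ _ ⟨a, rfl⟩ ⟨b, rfl⟩
  exact key _ _

end Quotient

/-! ### The flat torus -/

/-- The Euclidean plane. -/
abbrev Plane : Type := EuclideanSpace ℝ (Fin 2)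

/-- The lattice `ℤ²` in the plane. -/
def lattice : AddSubgroup Plane where
  carrier := {x | ∀ i, ∃ n : ℤ, x i = n}
  zero_mem' := fun i => ⟨0, by simp⟩
  add_mem' := by
    intro x y hx hy i
    obtain ⟨m, hm⟩ := hx i
    obtain ⟨n, hn⟩ := hy i
    exact ⟨m + n, by simp [hm, hn]⟩
  neg_mem' := by
    intro x hx i
    obtain ⟨m, hm⟩ := hx i
    exact ⟨-m, by simp [hm]⟩

/-- The torus `T² = ℝ² / ℤ²`. -/
abbrev Torus : Type := Plane ⧸ lattice

/-- The projection `ℝ² → T²`. -/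
def Torus.proj : Plane → Torus := QuotientAddGroup.mk

theorem lattice_eq_zero_of_norm_lt {x : Plane} (hx : x ∈ lattice) (h : ‖x‖ < 1) : x = 0 := by
  ext i
  obtain ⟨n, hn⟩ := hx i
  have h1 : |(n : ℝ)| < 1 := by
    rw [← hn]
    exact lt_of_le_of_lt (PiLp.norm_apply_le x i) h
  have : |n| < 1 := by exact_mod_cast h1
  have : n = 0 := Int.abs_lt_one_iff.mp this
  simp [hn, this]

theorem isDiscrete_lattice : IsDiscrete (lattice : Set Plane) := by
  constructor
  rw [discreteTopology_subtype_iff']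
  intro y hy
  refine ⟨ball y 1, isOpen_ball, ?_⟩
  ext z
  constructor
  · rintro ⟨hz, hzl⟩
    have := lattice_eq_zero_of_norm_lt (lattice.sub_mem hzl hy) (by simpa [dist_eq_norm] using hz)
    exact sub_eq_zero.mp this
  · rintro rfl
    exact ⟨mem_ball_self one_pos, hy⟩

theorem Torus.isLocalHomeomorph_proj : IsLocalHomeomorph Torus.proj :=
  (lattice.isAddQuotientCoveringMap_of_comm isDiscrete_lattice).isCoveringMap.isLocalHomeomorph

theorem Torus.proj_out : Function.RightInverse Quotient.out Torus.proj :=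
  fun q => Quotient.out_eq q

/-- The charts of `T²` are local inverses of the projection `ℝ² → T²`. -/
instance : ChartedSpace Plane Torus :=
  Torus.isLocalHomeomorph_proj.chartedSpaceOfRightInverse Torus.proj_out

theorem Torus.deck (x x' : Plane) (h : Torus.proj x = Torus.proj x') :
    Torus.proj ∘ (fun w => w + (x' - x)) = Torus.proj := by
  funext w
  have : -x + x' ∈ lattice := QuotientAddGroup.eq.mp h
  refine QuotientAddGroup.eq.mpr ?_
  have h2 : -(w + (x' - x)) + w = -(-x + x') := by abel
  rw [h2]
  exact lattice.neg_mem this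

instance : IsManifold 𝓘(ℝ, Plane) ∞ Torus :=
  isManifold_of_deck Torus.isLocalHomeomorph_proj Torus.proj_out fun x x' h =>
    ⟨fun w => w + (x' - x), (contDiff_id.add contDiff_const).contMDiff, Torus.deck x x' h,
      by simp⟩

/-- In a chart of `T²` the projection `ℝ² → T²` is locally a translation. -/
theorem Torus.chart_proj_eventually {b x : Plane}
    (hx : Torus.proj x ∈ (Torus.isLocalHomeomorph_proj.localInverseAt b).source) :
    ∀ᶠ w in 𝓝 x, Torus.isLocalHomeomorph_proj.localInverseAt b (Torus.proj w) =
      w + (Torus.isLocalHomeomorph_proj.localInverseAt b (Torus.proj x) - x) :=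
  localInverse_comp_eventually (τ := fun w => w + _) Torus.isLocalHomeomorph_proj hx
    (by fun_prop) (Torus.deck _ _ (Torus.isLocalHomeomorph_proj.apply_localInverseAt_of_mem hx).symm)
    (by simp)

theorem Torus.extChartAt_eq (q : Torus) :
    ⇑(extChartAt 𝓘(ℝ, Plane) q) = Torus.isLocalHomeomorph_proj.localInverseAt q.out := by
  ext1 x; rfl

theorem Torus.extChartAt_source (q : Torus) :
    (extChartAt 𝓘(ℝ, Plane) q).source =
      (Torus.isLocalHomeomorph_proj.localInverseAt q.out).source := by
  rw [_root_.extChartAt_source]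
  change (OpenPartialHomeomorph.trans _ (OpenPartialHomeomorph.refl Plane)).source = _
  simp

theorem Torus.hasMFDerivAt_proj (x : Plane) :
    HasMFDerivAt 𝓘(ℝ, Plane) 𝓘(ℝ, Plane) Torus.proj x (ContinuousLinearMap.id ℝ Plane) := by
  refine ⟨Torus.isLocalHomeomorph_proj.continuous.continuousAt, ?_⟩
  have hx : Torus.proj x ∈
      (Torus.isLocalHomeomorph_proj.localInverseAt (Torus.proj x).out).source := by
    rw [← Torus.extChartAt_source]; exact mem_extChartAt_source _
  have h := Torus.chart_proj_eventually hx
  have h1 : HasFDerivAt (fun w : Plane => w +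
      (Torus.isLocalHomeomorph_proj.localInverseAt (Torus.proj x).out (Torus.proj x) - x))
      (ContinuousLinearMap.id ℝ Plane) x := (hasFDerivAt_id x).add_const _
  have h2 := h1.congr_of_eventuallyEq h
  exact h2.hasFDerivWithinAt

theorem Torus.contMDiff_proj : ContMDiff 𝓘(ℝ, Plane) 𝓘(ℝ, Plane) ∞ Torus.proj := by
  intro x
  rw [contMDiffAt_iff_target]
  refine ⟨Torus.isLocalHomeomorph_proj.continuous.continuousAt, ?_⟩
  have hx : Torus.proj x ∈
      (Torus.isLocalHomeomorph_proj.localInverseAt (Torus.proj x).out).source := by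
    rw [← Torus.extChartAt_source]; exact mem_extChartAt_source _
  have h := Torus.chart_proj_eventually hx
  have h1 : ContMDiffAt 𝓘(ℝ, Plane) 𝓘(ℝ, Plane) ∞ (fun w : Plane => w +
      (Torus.isLocalHomeomorph_proj.localInverseAt (Torus.proj x).out (Torus.proj x) - x)) x :=
    (contDiff_id.add contDiff_const).contMDiff x
  exact h1.congr_of_eventuallyEq h

/-- The differential of a self-map of `T²` at `q`, as a linear map of the plane. The tangent spaces
of `T²` are identified with the plane by the differential of the projection `ℝ² → T²`, i.e. by the
flat parallelization. -/
def Torus.deriv (φ : Torus → Torus) (q : Torus) : Plane →L[ℝ] Plane :=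
  mfderiv 𝓘(ℝ, Plane) 𝓘(ℝ, Plane) φ q

theorem Torus.contMDiff_deriv {φ : Torus → Torus}
    (hφ : ContMDiff 𝓘(ℝ, Plane) 𝓘(ℝ, Plane) ∞ φ) :
    ContMDiff 𝓘(ℝ, Plane) 𝓘(ℝ, Plane →L[ℝ] Plane) ∞ (Torus.deriv φ) := by
  intro q
  let c := extChartAt 𝓘(ℝ, Plane) q
  let d := extChartAt 𝓘(ℝ, Plane) (φ q)
  let f : Plane → Plane := fun w => d (φ (Torus.proj w))
  have hcq : Torus.proj (c q) = q := by
    have := (Torus.isLocalHomeomorph_proj.apply_localInverseAt_of_mem (x := q.out) (y := q)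
      (by rw [← Torus.extChartAt_source]; exact mem_extChartAt_source _))
    exact this
  have hf : ContDiffAt ℝ ∞ f (c q) := by
    rw [← contMDiffAt_iff_contDiffAt]
    have h1 : ContMDiffAt 𝓘(ℝ, Plane) 𝓘(ℝ, Plane) ∞ (φ ∘ Torus.proj) (c q) :=
      (hφ.comp Torus.contMDiff_proj) _
    have h2 : ContMDiffAt 𝓘(ℝ, Plane) 𝓘(ℝ, Plane) ∞ d ((φ ∘ Torus.proj) (c q)) := by
      rw [Function.comp_apply, hcq]; exact contMDiffAt_extChartAt
    exact h2.comp (c q) h1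
  have hfd : ContDiffAt ℝ ∞ (fderiv ℝ f) (c q) := hf.fderiv_right le_rfl
  have hmain : ContMDiffAt 𝓘(ℝ, Plane) 𝓘(ℝ, Plane →L[ℝ] Plane) ∞ (fderiv ℝ f ∘ c) q :=
    hfd.contMDiffAt.comp q contMDiffAt_extChartAt
  refine hmain.congr_of_eventuallyEq ?_
  have hopen : ∀ᶠ y in 𝓝 q, y ∈ c.source ∧ φ y ∈ d.source :=
    Filter.Eventually.and (extChartAt_source_mem_nhds q)
      (hφ.continuous.continuousAt.eventually_mem (extChartAt_source_mem_nhds (φ q)))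
  filter_upwards [hopen.eventually_nhds] with y hy
  have hcy : Torus.proj (c y) = y := by
    have := (Torus.isLocalHomeomorph_proj.apply_localInverseAt_of_mem (x := q.out) (y := y)
      (by rw [← Torus.extChartAt_source]; exact hy.self_of_nhds.1))
    exact this
  have hev : ∀ᶠ w in 𝓝 (c y), (Torus.proj ∘ f) w = (φ ∘ Torus.proj) w := by
    have h3 : ∀ᶠ w in 𝓝 (c y), φ (Torus.proj w) ∈ d.source := by
      have : Filter.Tendsto Torus.proj (𝓝 (c y)) (𝓝 y) := by
        have := Torus.isLocalHomeomorph_proj.continuous.tendsto (c y)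
        rwa [hcy] at this
      exact (this.eventually hy).mono fun w hw => hw.2
    filter_upwards [h3] with w hw
    exact Torus.isLocalHomeomorph_proj.apply_localInverseAt_of_mem
      (by rw [← Torus.extChartAt_source]; exact hw)
  have hfy : DifferentiableAt ℝ f (c y) := by
    rw [← mdifferentiableAt_iff_differentiableAt]
    have h1 : MDifferentiableAt 𝓘(ℝ, Plane) 𝓘(ℝ, Plane) (φ ∘ Torus.proj) (c y) :=
      (hφ.comp Torus.contMDiff_proj).mdifferentiable (by simp) _
    have h2 : MDifferentiableAt 𝓘(ℝ, Plane) 𝓘(ℝ, Plane) d ((φ ∘ Torus.proj) (c y)) := by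
      rw [Function.comp_apply, hcy]
      exact mdifferentiableAt_extChartAt
        (by rw [← _root_.extChartAt_source 𝓘(ℝ, Plane)]; exact hy.self_of_nhds.2)
    exact h2.comp (c y) h1
  have hA : HasMFDerivAt 𝓘(ℝ, Plane) 𝓘(ℝ, Plane) (Torus.proj ∘ f) (c y) (fderiv ℝ f (c y)) := by
    have := (Torus.hasMFDerivAt_proj (f (c y))).comp (c y) hfy.hasFDerivAt.hasMFDerivAt
    exact this
  have hB : HasMFDerivAt 𝓘(ℝ, Plane) 𝓘(ℝ, Plane) (φ ∘ Torus.proj) (c y) (Torus.deriv φ y) := by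
    have h4 : HasMFDerivAt 𝓘(ℝ, Plane) 𝓘(ℝ, Plane) φ (Torus.proj (c y)) (Torus.deriv φ y) := by
      rw [hcy]
      exact (hφ.mdifferentiable (by simp) y).hasMFDerivAt
    have := h4.comp (c y) (Torus.hasMFDerivAt_proj (c y))
    exact this
  have hA' := hB.congr_of_eventuallyEq hev
  exact hasMFDerivAt_unique hA' hA

/-- A diffeomorphism of `T²` preserving the flat metric `g_st`. -/
def IsFlatIsometry (φ : Torus ≃ₘ⟮𝓘(ℝ, Plane), 𝓘(ℝ, Plane)⟯ Torus) : Prop :=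
  ∀ (q : Torus) (v : Plane), ‖Torus.deriv φ q v‖ = ‖v‖

theorem Torus.deriv_symm_apply (φ : Torus ≃ₘ⟮𝓘(ℝ, Plane), 𝓘(ℝ, Plane)⟯ Torus) (q : Torus)
    (v : Plane) : Torus.deriv φ.symm (φ q) (Torus.deriv φ q v) = v := by
  have h1 : HasMFDerivAt 𝓘(ℝ, Plane) 𝓘(ℝ, Plane) φ q (Torus.deriv φ q) :=
    (φ.contMDiff.mdifferentiable (by simp) q).hasMFDerivAt
  have h2 : HasMFDerivAt 𝓘(ℝ, Plane) 𝓘(ℝ, Plane) φ.symm (φ q) (Torus.deriv φ.symm (φ q)) :=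
    (φ.symm.contMDiff.mdifferentiable (by simp) _).hasMFDerivAt
  have h3 := h2.comp q h1
  have h4 : (φ.symm ∘ φ) = id := by ext1 x; simp
  rw [h4] at h3
  have h5 := hasMFDerivAt_unique h3 (hasMFDerivAt_id q)
  exact congrArg (fun A : Plane →L[ℝ] Plane => A v) h5

theorem IsFlatIsometry.symm {φ : Torus ≃ₘ⟮𝓘(ℝ, Plane), 𝓘(ℝ, Plane)⟯ Torus}
    (hφ : IsFlatIsometry φ) : IsFlatIsometry φ.symm := by
  intro q v
  have h1 := Torus.deriv_symm_apply φ.symm q v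
  have h2 := hφ (φ.symm q) (Torus.deriv φ.symm q v)
  rw [← h2]
  exact congrArg norm h1

/-- A closed geodesic of the flat torus: a nonconstant closed curve that is the projection of a
uniformly parametrized straight line of the plane. -/
def IsClosedGeodesic (γ : ℝ → Torus) : Prop :=
  (∃ x v : Plane, v ≠ 0 ∧ ∀ t, γ t = Torus.proj (x + t • v)) ∧ ∀ t, γ (t + 1) = γ t

/-- No positive iterate of `φ` maps the image of a closed geodesic onto itself. -/
def FixesNoClosedGeodesic (φ : Torus → Torus) : Prop :=
  ∀ n : ℕ, 0 < n → ∀ γ : ℝ → Torus, IsClosedGeodesic γ → φ^[n] '' range γ ≠ range γ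

/-! ### The unit cotangent bundle of the flat torus -/

instance : Fact (Module.finrank ℝ Plane = 1 + 1) := ⟨by simp⟩

/-- The unit cotangent bundle of the flat torus. The flat parallelization trivializes the cotangent
bundle, and the point `(q, p)` stands for the unit covector `v ↦ ⟪p, v⟫` at `q`. -/
abbrev UnitCotangent : Type := Torus × sphere (0 : Plane) 1

/-- The model of the unit cotangent bundle. -/
abbrev UnitCotangent.model :=
  (𝓘(ℝ, Plane)).prod (𝓡 1)

theorem contMDiff_lift {φ : Torus ≃ₘ⟮𝓘(ℝ, Plane), 𝓘(ℝ, Plane)⟯ Torus}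
    (hφ : IsFlatIsometry φ) :
    ContMDiff UnitCotangent.model UnitCotangent.model ∞
      (fun x : UnitCotangent => ((φ x.1, ⟨Torus.deriv φ x.1 x.2, by
        rw [mem_sphere_zero_iff_norm, hφ]; exact mem_sphere_zero_iff_norm.mp x.2.2⟩) :
          UnitCotangent)) := by
  refine (φ.contMDiff.comp contMDiff_fst).prodMk ?_
  apply ContMDiff.codRestrict_sphere
  have h1 : ContMDiff UnitCotangent.model 𝓘(ℝ, Plane →L[ℝ] Plane) ∞
      (fun x : UnitCotangent => Torus.deriv φ x.1) :=
    (Torus.contMDiff_deriv φ.contMDiff).comp contMDiff_fst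
  have h2 : ContMDiff UnitCotangent.model 𝓘(ℝ, Plane) ∞
      (fun x : UnitCotangent => (x.2 : Plane)) :=
    contMDiff_coe_sphere.comp contMDiff_snd
  exact h1.clm_apply h2

/-- The lift `φ̃ (q, p) = (φ q, p ∘ (dφ_q)⁻¹)` of an isometry of the flat torus to the unit
cotangent bundle. Since `dφ_q` is orthogonal, the covector `p ∘ (dφ_q)⁻¹` is represented by the
vector `dφ_q p`. -/
def unitCotangentLift (φ : Torus ≃ₘ⟮𝓘(ℝ, Plane), 𝓘(ℝ, Plane)⟯ Torus) (hφ : IsFlatIsometry φ) :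
    UnitCotangent ≃ₘ⟮UnitCotangent.model, UnitCotangent.model⟯ UnitCotangent where
  toFun x := (φ x.1, ⟨Torus.deriv φ x.1 x.2, by
    rw [mem_sphere_zero_iff_norm, hφ]; exact mem_sphere_zero_iff_norm.mp x.2.2⟩)
  invFun x := (φ.symm x.1, ⟨Torus.deriv φ.symm x.1 x.2, by
    rw [mem_sphere_zero_iff_norm, hφ.symm]; exact mem_sphere_zero_iff_norm.mp x.2.2⟩)
  left_inv := by
    rintro ⟨q, p⟩
    refine Prod.ext (φ.symm_apply_apply q) (Subtype.ext ?_)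
    exact Torus.deriv_symm_apply φ q p
  right_inv := by
    rintro ⟨q, p⟩
    refine Prod.ext (φ.apply_symm_apply q) (Subtype.ext ?_)
    exact Torus.deriv_symm_apply φ.symm q p
  contMDiff_toFun := contMDiff_lift hφ
  contMDiff_invFun := contMDiff_lift hφ.symm

/-! ### Mapping tori -/

section MappingTorus

variable {E : Type*} [NormedAddCommGroup E] [NormedSpace ℝ E]
  {H : Type*} [TopologicalSpace H] {I : ModelWithCorners ℝ E H}
  {C : Type*} [TopologicalSpace C] [ChartedSpace H C]

/-- The deck transformation `(x, θ) ↦ (ψⁿ x, θ + n)` of `C × ℝ`. -/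
def deck (ψ : C ≃ₘ⟮I, I⟯ C) (n : ℤ) (a : C × ℝ) : C × ℝ :=
  ((ψ.toEquiv ^ n : Equiv.Perm C) a.1, a.2 + n)

theorem deck_zero (ψ : C ≃ₘ⟮I, I⟯ C) (a : C × ℝ) : deck ψ 0 a = a := by
  simp [deck]

theorem deck_add (ψ : C ≃ₘ⟮I, I⟯ C) (m n : ℤ) (a : C × ℝ) :
    deck ψ m (deck ψ n a) = deck ψ (m + n) a := by
  simp only [deck, zpow_add, Equiv.Perm.mul_apply, Int.cast_add]
  refine Prod.ext rfl ?_
  simp only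
  ring

theorem contMDiff_zpow (ψ : C ≃ₘ⟮I, I⟯ C) (n : ℤ) :
    ContMDiff I I ∞ ((ψ.toEquiv ^ n : Equiv.Perm C) : C → C) := by
  have hnat : ∀ (χ : C ≃ₘ⟮I, I⟯ C) (k : ℕ),
      ContMDiff I I ∞ ((χ.toEquiv ^ k : Equiv.Perm C) : C → C) := by
    intro χ k
    induction k with
    | zero => exact contMDiff_id
    | succ k ih =>
      rw [pow_succ]
      exact ih.comp χ.contMDiff
  cases n with
  | ofNat k => simpa using hnat ψ k
  | negSucc k =>
    have : (ψ.toEquiv ^ Int.negSucc k : Equiv.Perm C) = ψ.symm.toEquiv ^ (k + 1) := by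
      rw [zpow_negSucc, ← inv_pow]; rfl
    rw [this]
    exact hnat ψ.symm (k + 1)

theorem contMDiff_deck (ψ : C ≃ₘ⟮I, I⟯ C) (n : ℤ) :
    ContMDiff (I.prod 𝓘(ℝ, ℝ)) (I.prod 𝓘(ℝ, ℝ)) ∞ (deck ψ n) := by
  refine ((contMDiff_zpow ψ n).comp contMDiff_fst).prodMk ?_
  have h : ContMDiff 𝓘(ℝ, ℝ) 𝓘(ℝ, ℝ) ∞ (fun t : ℝ => t + n) :=
    (contDiff_id.add contDiff_const).contMDiff
  exact h.comp contMDiff_snd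

/-- The equivalence relation on `C × ℝ` generated by `(x, θ) ∼ (ψ x, θ + 1)`. -/
def mappingTorusSetoid (ψ : C ≃ₘ⟮I, I⟯ C) : Setoid (C × ℝ) where
  r a b := ∃ n : ℤ, deck ψ n a = b
  iseqv :=
    { refl := fun a => ⟨0, deck_zero ψ a⟩
      symm := by
        rintro a _ ⟨n, rfl⟩
        exact ⟨-n, by rw [deck_add, neg_add_cancel, deck_zero]⟩
      trans := by
        rintro a _ _ ⟨m, rfl⟩ ⟨n, rfl⟩
        exact ⟨n + m, by rw [deck_add]⟩ }

/-- The mapping torus `C × ℝ / (x, θ) ∼ (ψ x, θ + 1)` of a diffeomorphism `ψ` of `C`. -/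
def MappingTorus (ψ : C ≃ₘ⟮I, I⟯ C) : Type _ := Quotient (mappingTorusSetoid ψ)

instance (ψ : C ≃ₘ⟮I, I⟯ C) : TopologicalSpace (MappingTorus ψ) :=
  inferInstanceAs (TopologicalSpace (Quotient (mappingTorusSetoid ψ)))

/-- The projection of `C × ℝ` to the mapping torus. -/
def MappingTorus.proj (ψ : C ≃ₘ⟮I, I⟯ C) : C × ℝ → MappingTorus ψ :=
  Quotient.mk (mappingTorusSetoid ψ)

/-- A point of `C × ℝ` over a given point of the mapping torus. -/
def MappingTorus.out {ψ : C ≃ₘ⟮I, I⟯ C} : MappingTorus ψ → C × ℝ := Quotient.out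

theorem MappingTorus.proj_eq_iff (ψ : C ≃ₘ⟮I, I⟯ C) (a b : C × ℝ) :
    MappingTorus.proj ψ a = MappingTorus.proj ψ b ↔ ∃ n : ℤ, deck ψ n a = b :=
  Quotient.eq (r := mappingTorusSetoid ψ)

theorem MappingTorus.proj_deck (ψ : C ≃ₘ⟮I, I⟯ C) (n : ℤ) :
    MappingTorus.proj ψ ∘ deck ψ n = MappingTorus.proj ψ := by
  funext a
  exact ((MappingTorus.proj_eq_iff ψ _ _).mpr ⟨n, rfl⟩).symm

theorem MappingTorus.proj_out (ψ : C ≃ₘ⟮I, I⟯ C) :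
    Function.RightInverse MappingTorus.out (MappingTorus.proj ψ) :=
  fun m => Quotient.out_eq m

theorem MappingTorus.continuous_proj (ψ : C ≃ₘ⟮I, I⟯ C) : Continuous (MappingTorus.proj ψ) :=
  continuous_quotient_mk'

theorem MappingTorus.isOpenMap_proj (ψ : C ≃ₘ⟮I, I⟯ C) : IsOpenMap (MappingTorus.proj ψ) := by
  intro U hU
  have h : MappingTorus.proj ψ ⁻¹' (MappingTorus.proj ψ '' U) = ⋃ n : ℤ, deck ψ n ⁻¹' U := by
    ext a
    simp only [mem_preimage, mem_image, mem_iUnion]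
    constructor
    · rintro ⟨b, hb, hba⟩
      obtain ⟨n, rfl⟩ := (MappingTorus.proj_eq_iff ψ a b).mp hba.symm
      exact ⟨n, hb⟩
    · rintro ⟨n, hn⟩
      exact ⟨_, hn, congrFun (MappingTorus.proj_deck ψ n) a⟩
  have h2 : IsOpen (MappingTorus.proj ψ ⁻¹' (MappingTorus.proj ψ '' U)) := by
    rw [h]
    exact isOpen_iUnion fun n => hU.preimage (contMDiff_deck ψ n).continuous
  exact isQuotientMap_quotient_mk'.isOpen_preimage.mp h2

theorem MappingTorus.isLocalHomeomorph_proj (ψ : C ≃ₘ⟮I, I⟯ C) :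
    IsLocalHomeomorph (MappingTorus.proj ψ) := by
  rw [isLocalHomeomorph_iff_isLocalHomeomorphOn_univ,
    isLocalHomeomorphOn_iff_isOpenEmbedding_restrict]
  rintro ⟨x, θ⟩ -
  have hU : IsOpen ((univ : Set C) ×ˢ ball θ (1 / 2)) := isOpen_univ.prod isOpen_ball
  refine ⟨_, hU.mem_nhds ⟨mem_univ _, mem_ball_self (by norm_num)⟩, ?_⟩
  refine Topology.IsOpenEmbedding.of_continuous_injective_isOpenMap
    ((MappingTorus.continuous_proj ψ).comp continuous_subtype_val) ?_
    ((MappingTorus.isOpenMap_proj ψ).comp hU.isOpenMap_subtype_val)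
  rintro ⟨a, ha⟩ ⟨b, hb⟩ hab
  obtain ⟨n, hn⟩ := (MappingTorus.proj_eq_iff ψ a b).mp hab
  have h1 : a.2 + n = b.2 := congrArg Prod.snd hn
  have ha2 : |a.2 - θ| < 1 / 2 := ha.2
  have hb2 : |b.2 - θ| < 1 / 2 := hb.2
  rw [abs_lt] at ha2 hb2
  have hn1 : (n : ℝ) < 1 := by linarith
  have hn2 : (-1 : ℝ) < n := by linarith
  have h3 : n < 1 := by exact_mod_cast hn1
  have h4 : -1 < n := by exact_mod_cast hn2
  obtain rfl : n = 0 := by omega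
  rw [deck_zero] at hn
  exact Subtype.ext hn

/-- The charts of the mapping torus are local inverses of the projection followed by charts of
`C × ℝ`. -/
instance (ψ : C ≃ₘ⟮I, I⟯ C) : ChartedSpace (ModelProd H ℝ) (MappingTorus ψ) :=
  (MappingTorus.isLocalHomeomorph_proj ψ).chartedSpaceOfRightInverse (MappingTorus.proj_out ψ)

instance [IsManifold I ∞ C] (ψ : C ≃ₘ⟮I, I⟯ C) :
    IsManifold (I.prod 𝓘(ℝ, ℝ)) ∞ (MappingTorus ψ) :=
  isManifold_of_deck (MappingTorus.isLocalHomeomorph_proj ψ) (MappingTorus.proj_out ψ)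
    fun a b h => by
      obtain ⟨n, hn⟩ := (MappingTorus.proj_eq_iff ψ a b).mp h
      exact ⟨deck ψ n, contMDiff_deck ψ n, MappingTorus.proj_deck ψ n, hn⟩

end MappingTorus

/-! ### One-forms and exact lcs structures -/

section Forms

variable {E : Type*} [NormedAddCommGroup E] [NormedSpace ℝ E]
  {H : Type*} [TopologicalSpace H] (I : ModelWithCorners ℝ E H)
  (M : Type*) [TopologicalSpace M] [ChartedSpace H M]

/-- A (not necessarily smooth) 1-form on a manifold. -/
abbrev OneForm : Type _ := ∀ x : M, TangentSpace I x →L[ℝ] ℝ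

variable {I M}

/-- The pullback of a 1-form to the model vector space by the inverse of the chart at `x₀`. -/
def OneForm.inChart (η : OneForm I M) (x₀ : M) (y : E) : E →L[ℝ] ℝ :=
  (η ((extChartAt I x₀).symm y)).comp (mfderiv 𝓘(ℝ, E) I (extChartAt I x₀).symm y)

/-- Smoothness of a 1-form on a manifold without boundary. -/
def OneForm.IsSmooth (η : OneForm I M) : Prop :=
  ∀ x₀ : M, ContDiffOn ℝ ∞ (η.inChart x₀) (extChartAt I x₀).target

/-- The exterior derivative `dη (v, w) = v (η w) - w (η v)` at `x`, computed in the chart at `x`,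
through which Mathlib identifies the tangent space at `x` with the model vector space. -/
def OneForm.d (η : OneForm I M) (x : M) :
    TangentSpace I x →L[ℝ] TangentSpace I x →L[ℝ] ℝ :=
  let D : E →L[ℝ] E →L[ℝ] ℝ := fderiv ℝ (η.inChart x) (extChartAt I x x)
  D - D.flip

/-- The wedge product `(α ∧ β) (v, w) = α v * β w - β v * α w`. -/
def OneForm.wedge (α β : OneForm I M) (x : M) :
    TangentSpace I x →L[ℝ] TangentSpace I x →L[ℝ] ℝ :=
  (α x).smulRight (β x) - (β x).smulRight (α x)

/-- The 2-form `d_α lam = d lam - α ∧ lam`. -/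
def lcsForm (lam α : OneForm I M) (x : M) :
    TangentSpace I x →L[ℝ] TangentSpace I x →L[ℝ] ℝ :=
  lam.d x - α.wedge lam x

/-- `(lam, α)` is an exact lcs structure: `α` is closed and `d_α lam` is non-degenerate. -/
structure IsExactLcs (lam α : OneForm I M) : Prop where
  smooth_lam : lam.IsSmooth
  smooth_alpha : α.IsSmooth
  closed : ∀ x, α.d x = 0
  nondegenerate : ∀ (x : M) (v : TangentSpace I x), (∀ w, lcsForm lam α x v w = 0) → v = 0

/-- The canonical distribution of `(lam, α)`: at each point the span of the vectors `X_lam` and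
`X_α` that solve `ω (X_lam, ·) = lam` and `ω (X_α, ·) = α`, where `ω = d_α lam`. For a
non-degenerate `ω` these two vectors are unique. -/
def canonicalDistribution (lam α : OneForm I M) (x : M) : Submodule ℝ (TangentSpace I x) :=
  Submodule.span ℝ {X | lcsForm lam α x X = lam x ∨ lcsForm lam α x X = α x}

end Forms

/-! ### Nodal Riemann surfaces and Reeb 2-curves -/

/-- A closed nodal Riemann surface: a closed (not necessarily connected) Riemann surface, the
normalization, with finitely many pairwise disjoint pairs of distinct points. -/
structure NodalRiemannSurface where
  /-- The normalization. -/
  Normalization : Type v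
  [topologicalSpace : TopologicalSpace Normalization]
  [chartedSpace : ChartedSpace ℂ Normalization]
  [isManifold : IsManifold 𝓘(ℂ) ω Normalization]
  [t2Space : T2Space Normalization]
  [compactSpace : CompactSpace Normalization]
  /-- The pairs of points that are glued to nodes. -/
  nodes : Finset (Normalization × Normalization)
  ne_of_mem : ∀ P ∈ nodes, P.1 ≠ P.2
  disjoint : ∀ P ∈ nodes, ∀ Q ∈ nodes, P ≠ Q →
    P.1 ≠ Q.1 ∧ P.1 ≠ Q.2 ∧ P.2 ≠ Q.1 ∧ P.2 ≠ Q.2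

attribute [instance] NodalRiemannSurface.topologicalSpace NodalRiemannSurface.chartedSpace
  NodalRiemannSurface.isManifold NodalRiemannSurface.t2Space NodalRiemannSurface.compactSpace

namespace NodalRiemannSurface

/-- The underlying space: the quotient of the normalization by the equivalence relation generated
by gluing the two points of each pair. -/
def Space (S : NodalRiemannSurface.{v}) : Type _ :=
  Quot fun a b : S.Normalization => (a, b) ∈ S.nodes

/-- The quotient map from the normalization. -/
def quotientMap (S : NodalRiemannSurface.{v}) : S.Normalization → S.Space := Quot.mk _

/-- The class in `H¹(S, ℝ)` of a closed real 1-form `η` on the normalization vanishes.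
Here `H¹(S, ℝ)`, the cohomology of the glued space, is computed by the de Rham complex of `S`: its
functions are the functions on the glued space that are smooth on the normalization, and its
1- and 2-forms are those of the normalization. So the class vanishes if and only if `η` has a
primitive on the normalization that takes equal values at the two points of each node. -/
def ClassVanishes (S : NodalRiemannSurface.{v}) (η : OneForm 𝓘(ℝ, ℂ) S.Normalization) : Prop :=
  ∃ f : S.Space → ℝ, ContMDiff 𝓘(ℝ, ℂ) 𝓘(ℝ, ℝ) ∞ (f ∘ S.quotientMap) ∧
    ∀ z, η z = (mfderiv 𝓘(ℝ, ℂ) 𝓘(ℝ, ℝ) (f ∘ S.quotientMap) z : TangentSpace 𝓘(ℝ, ℂ) z →L[ℝ] ℝ)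

end NodalRiemannSurface

section Reeb

variable {E : Type*} [NormedAddCommGroup E] [NormedSpace ℝ E]
  {H : Type*} [TopologicalSpace H] {I : ModelWithCorners ℝ E H}
  {M : Type*} [TopologicalSpace M] [ChartedSpace H M]

/-- The map `u` from the nodal Riemann surface `S` is a Reeb 2-curve in `(M, lam, α)`. -/
structure IsReebTwoCurve (lam α : OneForm I M) (S : NodalRiemannSurface.{v}) (u : S.Space → M) :
    Prop where
  /-- The normalization of `u` is smooth. -/
  smooth : ContMDiff 𝓘(ℝ, ℂ) I ∞ (u ∘ S.quotientMap)
  /-- Where its differential is nonzero and the canonical distribution is 2-dimensional, the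
  normalization is tangent to the canonical distribution. -/
  tangent : ∀ z : S.Normalization,
    mfderiv 𝓘(ℝ, ℂ) I (u ∘ S.quotientMap) z ≠ 0 →
    Module.finrank ℝ (canonicalDistribution lam α ((u ∘ S.quotientMap) z)) = 2 →
    LinearMap.range (mfderiv 𝓘(ℝ, ℂ) I (u ∘ S.quotientMap) z).toLinearMap =
      canonicalDistribution lam α ((u ∘ S.quotientMap) z)
  /-- The class `[u^* α]` in `H¹(S, ℝ)` is nonzero. -/
  class_ne_zero : ¬ S.ClassVanishes fun z =>
    (α ((u ∘ S.quotientMap) z)).comp (mfderiv 𝓘(ℝ, ℂ) I (u ∘ S.quotientMap) z)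

/-- `(M, lam, α)` has a Reeb 2-curve. -/
def HasReebTwoCurve (lam α : OneForm I M) : Prop :=
  ∃ (S : NodalRiemannSurface.{v}) (u : S.Space → M), IsReebTwoCurve lam α S u

end Reeb

/-- The naive lcs analogue of the Weinstein conjecture: every closed (nonempty,
positive-dimensional) exact lcs manifold has a Reeb 2-curve. -/
def NaiveLcsWeinstein : Prop :=
  ∀ (E : Type) [NormedAddCommGroup E] [NormedSpace ℝ E] [FiniteDimensional ℝ E] [Nontrivial E]
    (H : Type) [TopologicalSpace H] (I : ModelWithCorners ℝ E H) [I.Boundaryless]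
    (M : Type) [TopologicalSpace M] [ChartedSpace H M] [IsManifold I ∞ M]
    [T2Space M] [CompactSpace M] [Nonempty M] (lam α : OneForm I M),
    IsExactLcs lam α → HasReebTwoCurve.{0} lam α

/-! ### The lcs structure of the mapping torus -/

section MappingTorusForms

variable {E : Type*} [NormedAddCommGroup E] [NormedSpace ℝ E]
  {H : Type*} [TopologicalSpace H] {I : ModelWithCorners ℝ E H}
  {C : Type*} [TopologicalSpace C] [ChartedSpace H C]

/-- The 1-form on the mapping torus whose pullback to `C × ℝ` is the given deck-invariant 1-form
`η`: a tangent vector is lifted to `C × ℝ` by the inverse of the differential of the projection. -/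
def MappingTorus.descend (ψ : C ≃ₘ⟮I, I⟯ C) (η : OneForm (I.prod 𝓘(ℝ, ℝ)) (C × ℝ)) :
    OneForm (I.prod 𝓘(ℝ, ℝ)) (MappingTorus ψ) :=
  fun m => (η m.out).comp
    (mfderiv (I.prod 𝓘(ℝ, ℝ)) (I.prod 𝓘(ℝ, ℝ)) (MappingTorus.proj ψ) m.out).inverse

/-- The form `lam_ψ` on the mapping torus of a strict contactomorphism `ψ` of `(C, lam)`; its
pullback to `C × ℝ` is the pullback of `lam` by the projection to `C`. -/
def MappingTorus.lam (ψ : C ≃ₘ⟮I, I⟯ C) (lam : OneForm I C) :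
    OneForm (I.prod 𝓘(ℝ, ℝ)) (MappingTorus ψ) :=
  MappingTorus.descend ψ fun a => (lam a.1).comp (mfderiv (I.prod 𝓘(ℝ, ℝ)) I Prod.fst a)

/-- The Lee form `α` on the mapping torus; its pullback to `C × ℝ` is `dθ`. -/
def MappingTorus.alpha (ψ : C ≃ₘ⟮I, I⟯ C) : OneForm (I.prod 𝓘(ℝ, ℝ)) (MappingTorus ψ) :=
  MappingTorus.descend ψ fun a => mfderiv (I.prod 𝓘(ℝ, ℝ)) 𝓘(ℝ, ℝ) Prod.snd a

end MappingTorusForms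

/-- The Liouville 1-form of the unit cotangent bundle of the flat torus: a tangent vector `ξ` at
`(q, p)` is sent to `p (dπ ξ)`, with `π` the projection to the torus. -/
def liouville : OneForm UnitCotangent.model UnitCotangent :=
  fun x => (innerSL ℝ (x.2 : Plane)).comp
    (mfderiv UnitCotangent.model 𝓘(ℝ, Plane) (Prod.fst : UnitCotangent → Torus) x)

end LCS

end

noncomputable section

namespace LCS

section QuotientSmooth

variable {E : Type*} [NormedAddCommGroup E] [NormedSpace ℝ E]
  {H : Type*} [TopologicalSpace H] {I : ModelWithCorners ℝ E H}
  {X : Type*} [TopologicalSpace X] [ChartedSpace H X]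
  {Y : Type*} [TopologicalSpace Y]

theorem extChartAt_quotient {p : X → Y} (hp : IsLocalHomeomorph p) {g : Y → X}
    (hg : Function.RightInverse g p) (y : Y) :
    (letI := hp.chartedSpaceOfRightInverse (H := H) hg; ⇑(extChartAt I y)) =
      extChartAt I (g y) ∘ hp.localInverseAt (g y) := by
  ext1 x; rfl

theorem extChartAt_quotient_symm {p : X → Y} (hp : IsLocalHomeomorph p) {g : Y → X}
    (hg : Function.RightInverse g p) (y : Y) :
    (letI := hp.chartedSpaceOfRightInverse (H := H) hg; ⇑(extChartAt I y).symm) =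
      p ∘ (extChartAt I (g y)).symm := by
  ext1 x
  change (hp.localInverseAt (g y)).symm _ = _
  rw [hp.localInverseAt_symm]; rfl

theorem localInverseAt_self {p : X → Y} (hp : IsLocalHomeomorph p) {g : Y → X}
    (hg : Function.RightInverse g p) (y : Y) : hp.localInverseAt (g y) y = g y := by
  conv_lhs => rw [← hg y]
  rw [hg y]
  have := hp.localInverseAt_apply_self (x := g y)
  rwa [hg y] at this

/-- The projection to a quotient by smooth deck transformations is smooth. -/
theorem contMDiff_of_deck [IsManifold I ∞ X] {p : X → Y} (hp : IsLocalHomeomorph p)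
    {g : Y → X} (hg : Function.RightInverse g p)
    (hdeck : ∀ x x', p x = p x' → ∃ τ : X → X, ContMDiff I I ∞ τ ∧ p ∘ τ = p ∧ τ x = x') :
    @ContMDiff ℝ _ E _ _ H _ I X _ _ E _ _ H _ I Y _ (hp.chartedSpaceOfRightInverse hg) ∞ p := by
  let _ := hp.chartedSpaceOfRightInverse (H := H) hg
  intro x
  rw [contMDiffAt_iff_target]
  refine ⟨hp.continuous.continuousAt, ?_⟩
  rw [extChartAt_quotient hp hg]
  have hself := localInverseAt_self hp hg (p x)
  have hsrc : p x ∈ (hp.localInverseAt (g (p x))).source := by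
    have := hp.apply_self_mem_localInverseAt_source (x := g (p x))
    rwa [hg] at this
  obtain ⟨τ, hτ, hpτ, hτx⟩ := hdeck x (g (p x)) (hg _).symm
  have hev := localInverse_comp_eventually hp hsrc hτ.continuous hpτ (hτx.trans hself.symm)
  have h1 : ContMDiffAt I 𝓘(ℝ, E) ∞ (extChartAt I (g (p x))) (τ x) := by
    rw [hτx]; exact contMDiffAt_extChartAt
  refine (h1.comp x (hτ x)).congr_of_eventuallyEq ?_
  filter_upwards [hev] with w hw
  simp [hw]

/-- The local inverses of the projection to a quotient by smooth deck transformations are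
smooth. -/
theorem contMDiffAt_localInverse_of_deck [IsManifold I ∞ X] {p : X → Y}
    (hp : IsLocalHomeomorph p) {g : Y → X} (hg : Function.RightInverse g p)
    (hdeck : ∀ x x', p x = p x' → ∃ τ : X → X, ContMDiff I I ∞ τ ∧ p ∘ τ = p ∧ τ x = x')
    {b : X} {y : Y} (hy : y ∈ (hp.localInverseAt b).source) :
    @ContMDiffAt ℝ _ E _ _ H _ I Y _ (hp.chartedSpaceOfRightInverse hg) E _ _ H _ I X _ _ ∞
      (hp.localInverseAt b) y := by
  let _ := hp.chartedSpaceOfRightInverse (H := H) hg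
  rw [contMDiffAt_iff_source, extChartAt_quotient_symm hp hg, extChartAt_quotient hp hg]
  have hself := localInverseAt_self hp hg y
  obtain ⟨τ, hτ, hpτ, hτx⟩ := hdeck (g y) (hp.localInverseAt b y)
    (by rw [hg, hp.apply_localInverseAt_of_mem hy])
  have hev := localInverse_comp_eventually (x := g y) hp (by rwa [hg]) hτ.continuous hpτ
    (by rw [hτx, hg])
  simp only [Function.comp_apply, hself]
  have hs : ContMDiffWithinAt 𝓘(ℝ, E) I ∞ (extChartAt I (g y)).symm (range I)
      (extChartAt I (g y) (g y)) :=
    contMDiffWithinAt_extChartAt_symm_range (g y) (mem_extChartAt_target (g y))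
  have hxz : (extChartAt I (g y)).symm (extChartAt I (g y) (g y)) = g y := by simp
  have h1 := ContMDiffAt.comp_contMDiffWithinAt (g := τ) _ (hτ _) hs
  refine h1.congr_of_eventuallyEq ?_ ?_
  · have : ∀ᶠ w in 𝓝 ((extChartAt I (g y)).symm (extChartAt I (g y) (g y))),
        hp.localInverseAt b (p w) = τ w := by rw [hxz]; exact hev
    exact hs.continuousWithinAt.tendsto.eventually this
  · simp [hg y, hτx]

end QuotientSmooth

theorem Torus.exists_smooth_deck (x x' : Plane) (h : Torus.proj x = Torus.proj x') :
    ∃ τ : Plane → Plane, ContMDiff 𝓘(ℝ, Plane) 𝓘(ℝ, Plane) ∞ τ ∧ Torus.proj ∘ τ = Torus.proj ∧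
      τ x = x' :=
  ⟨fun w => w + (x' - x), (contDiff_id.add contDiff_const).contMDiff, Torus.deck x x' h, by simp⟩

theorem Torus.contMDiffAt_localInverse {b : Plane} {q : Torus}
    (hq : q ∈ (Torus.isLocalHomeomorph_proj.localInverseAt b).source) :
    ContMDiffAt 𝓘(ℝ, Plane) 𝓘(ℝ, Plane) ∞ (Torus.isLocalHomeomorph_proj.localInverseAt b) q :=
  contMDiffAt_localInverse_of_deck Torus.isLocalHomeomorph_proj Torus.proj_out
    Torus.exists_smooth_deck hq

theorem Torus.surjective_proj : Function.Surjective Torus.proj :=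
  QuotientAddGroup.mk_surjective

theorem Torus.proj_add (x y : Plane) : Torus.proj (x + y) = Torus.proj x + Torus.proj y := rfl

theorem Torus.proj_eq_iff {x y : Plane} : Torus.proj x = Torus.proj y ↔ y - x ∈ lattice := by
  rw [sub_eq_neg_add]
  exact QuotientAddGroup.eq

theorem Torus.isCoveringMap_proj : IsCoveringMap Torus.proj :=
  (lattice.isAddQuotientCoveringMap_of_comm isDiscrete_lattice).isCoveringMap

theorem isClosed_lattice : IsClosed (lattice : Set Plane) := by
  have : (lattice : Set Plane) = ⋂ i, (fun x : Plane => x i) ⁻¹' (range ((↑) : ℤ → ℝ)) := by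
    ext x
    simp only [SetLike.mem_coe, mem_iInter, mem_preimage, mem_range]
    exact forall_congr' fun i => ⟨fun ⟨n, hn⟩ => ⟨n, hn.symm⟩, fun ⟨n, hn⟩ => ⟨n, hn.symm⟩⟩
  rw [this]
  exact isClosed_iInter fun i => Int.isClosedEmbedding_coe_real.isClosed_range.preimage
    (by fun_prop)

instance : T2Space Torus := by
  have : IsClosed (lattice : Set Plane) := isClosed_lattice
  infer_instance

instance : CompactSpace Torus := by
  refine ⟨?_⟩
  have h : (univ : Set Torus) = Torus.proj '' closedBall 0 2 := by
    refine (eq_univ_of_forall fun q => ?_).symm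
    obtain ⟨x, rfl⟩ := Torus.surjective_proj q
    refine ⟨!₂[Int.fract (x 0), Int.fract (x 1)], ?_, ?_⟩
    · rw [mem_closedBall_zero_iff, EuclideanSpace.norm_eq, Real.sqrt_le_left (by norm_num)]
      simp only [Fin.sum_univ_two, Real.norm_eq_abs, sq_abs]
      have h0 := Int.fract_nonneg (x 0)
      have h1 := Int.fract_nonneg (x 1)
      have h2 := (Int.fract_lt_one (x 0)).le
      have h3 := (Int.fract_lt_one (x 1)).le
      simp
      nlinarith
    · rw [Torus.proj_eq_iff]
      intro i
      fin_cases i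
      · exact ⟨⌊x 0⌋, by simp⟩
      · exact ⟨⌊x 1⌋, by simp⟩
  rw [h]
  exact (isCompact_closedBall 0 2).image Torus.isLocalHomeomorph_proj.continuous

instance : ConnectedSpace Torus :=
  Torus.surjective_proj.connectedSpace Torus.isLocalHomeomorph_proj.continuous

/-- A continuous self-map of the torus lifts to the plane. -/
theorem Torus.exists_lift {φ : Torus → Torus} (hφ : Continuous φ) :
    ∃ Φ : Plane → Plane, Continuous Φ ∧ ∀ x, Torus.proj (Φ x) = φ (Torus.proj x) := by
  obtain ⟨e, he⟩ := Torus.surjective_proj (φ (Torus.proj 0))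
  obtain ⟨F, ⟨-, hF⟩, -⟩ := Torus.isCoveringMap_proj.existsUnique_continuousMap_lifts
    ⟨fun x => φ (Torus.proj x), hφ.comp Torus.isLocalHomeomorph_proj.continuous⟩ 0 e he
  exact ⟨F, F.continuous, fun x => congrFun hF x⟩

/-- A smooth self-map of the torus and a lift to the plane have the same derivative. -/
theorem Torus.hasFDerivAt_lift {φ : Torus → Torus}
    (hφ : ContMDiff 𝓘(ℝ, Plane) 𝓘(ℝ, Plane) ∞ φ) {Φ : Plane → Plane} (hΦ : Continuous Φ)
    (h : ∀ x, Torus.proj (Φ x) = φ (Torus.proj x)) (x : Plane) :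
    HasFDerivAt Φ (Torus.deriv φ (Torus.proj x)) x := by
  have hφ' : HasMFDerivAt 𝓘(ℝ, Plane) 𝓘(ℝ, Plane) φ (Torus.proj x)
      (Torus.deriv φ (Torus.proj x)) := (hφ.mdifferentiable (by simp) _).hasMFDerivAt
  have h1 : HasMFDerivAt 𝓘(ℝ, Plane) 𝓘(ℝ, Plane) (φ ∘ Torus.proj) x
      (Torus.deriv φ (Torus.proj x)) := hφ'.comp x (Torus.hasMFDerivAt_proj x)
  set ℓ := Torus.isLocalHomeomorph_proj.localInverseAt (Φ x) with hℓ
  have hsrc : Torus.proj (Φ x) ∈ ℓ.source :=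
    Torus.isLocalHomeomorph_proj.apply_self_mem_localInverseAt_source
  have hself : ℓ (Torus.proj (Φ x)) = Φ x :=
    Torus.isLocalHomeomorph_proj.localInverseAt_apply_self
  have hev : ∀ᶠ w in 𝓝 (Φ x), ℓ (Torus.proj w) = w :=
    localInverse_comp_eventually (τ := id) Torus.isLocalHomeomorph_proj hsrc continuous_id
      rfl hself.symm
  have h2 : HasMFDerivAt 𝓘(ℝ, Plane) 𝓘(ℝ, Plane) ℓ (Torus.proj (Φ x))
      (ContinuousLinearMap.id ℝ Plane) := by
    have hd := ((Torus.contMDiffAt_localInverse hsrc).mdifferentiableAt (by simp)).hasMFDerivAt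
    have hc := (hd.comp (Φ x) (Torus.hasMFDerivAt_proj (Φ x))).congr_of_eventuallyEq
      (f₁ := id) (hev.mono fun w hw => hw.symm)
    have := hasMFDerivAt_unique hc (hasMFDerivAt_id (Φ x))
    rw [← hℓ] at hd
    have h0 : mfderiv 𝓘(ℝ, Plane) 𝓘(ℝ, Plane) ℓ (Torus.proj (Φ x)) =
        ContinuousLinearMap.id ℝ Plane := (ContinuousLinearMap.comp_id _).symm.trans this
    exact h0 ▸ hd
  rw [h x] at h2
  have h3 : HasMFDerivAt 𝓘(ℝ, Plane) 𝓘(ℝ, Plane) (ℓ ∘ (φ ∘ Torus.proj)) x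
      (Torus.deriv φ (Torus.proj x)) := h2.comp x h1
  refine HasMFDerivAt.hasFDerivAt (h3.congr_of_eventuallyEq ?_)
  filter_upwards [hΦ.continuousAt.eventually hev] with w hw
  simp [← h, hw]

theorem lattice_translate_const {f : Plane → Plane} (hf : Continuous f)
    (h : ∀ x, f x - x ∈ lattice) : ∃ c, ∀ x, f x = x + c := by
  have : DiscreteTopology lattice := isDiscrete_lattice.to_subtype
  let k : Plane → lattice := fun x => ⟨f x - x, h x⟩
  have hk : Continuous k := (hf.sub continuous_id).subtype_mk _
  refine ⟨k 0, fun x => ?_⟩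
  have := PreconnectedSpace.constant inferInstance hk (x := x) (y := 0)
  rw [← this]; simp [k]

/-- Isometries of the flat torus are affine. -/
theorem IsFlatIsometry.exists_affine {φ : Torus ≃ₘ⟮𝓘(ℝ, Plane), 𝓘(ℝ, Plane)⟯ Torus}
    (hφ : IsFlatIsometry φ) :
    ∃ A : Plane →ₗᵢ[ℝ] Plane, (∀ q, Torus.deriv φ q = A.toContinuousLinearMap) ∧
      ∀ q v, φ (q + Torus.proj v) = φ q + Torus.proj (A v) := by
  have key : ∀ {φ : Torus ≃ₘ⟮𝓘(ℝ, Plane), 𝓘(ℝ, Plane)⟯ Torus}, IsFlatIsometry φ →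
      ∃ Φ : Plane → Plane, Continuous Φ ∧ (∀ x, Torus.proj (Φ x) = φ (Torus.proj x)) ∧
        (∀ x, HasFDerivAt Φ (Torus.deriv φ (Torus.proj x)) x) ∧
        ∀ x y, dist (Φ x) (Φ y) ≤ dist x y := by
    intro φ hφ
    obtain ⟨Φ, hΦ, h⟩ := Torus.exists_lift φ.continuous
    have hd := Torus.hasFDerivAt_lift φ.contMDiff hΦ h
    refine ⟨Φ, hΦ, h, hd, fun x y => ?_⟩
    have := convex_univ.norm_image_sub_le_of_norm_hasFDerivWithin_le (C := 1)
      (fun z _ => (hd z).hasFDerivWithinAt)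
      (fun z _ => ContinuousLinearMap.opNorm_le_bound _ zero_le_one fun v => by
        rw [hφ]; simp) (mem_univ y) (mem_univ x)
    rw [one_mul] at this
    simpa [dist_eq_norm] using this
  obtain ⟨Φ, hΦ, h, hd, hlip⟩ := key hφ
  obtain ⟨Ψ, hΨ, h', -, hlip'⟩ := key hφ.symm
  obtain ⟨c, hc⟩ := lattice_translate_const (hΨ.comp hΦ) fun x => by
    rw [← Torus.proj_eq_iff, Function.comp_apply, h', h]; simp
  have hiso : Isometry Φ := Isometry.of_dist_eq fun x y => by
    refine le_antisymm (hlip x y) ?_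
    have := hlip' (Φ x) (Φ y)
    rwa [show Ψ (Φ x) = x + c from hc x, show Ψ (Φ y) = y + c from hc y, dist_add_right] at this
  let L := hiso.affineIsometryOfStrictConvexSpace
  have hL : ∀ x v, Φ (x + v) = Φ x + L.linearIsometry v := by
    intro x v
    have := L.map_vadd x v
    simp only [vadd_eq_add, add_comm] at this
    exact this
  refine ⟨L.linearIsometry, fun q => ?_, fun q v => ?_⟩
  · obtain ⟨x, rfl⟩ := Torus.surjective_proj q
    have h1 : HasFDerivAt Φ L.linearIsometry.toContinuousLinearMap x := by
      have h2 : Φ = fun y => Φ x + L.linearIsometry.toContinuousLinearMap (y - x) := by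
        funext y
        have := hL x (y - x)
        rw [add_sub_cancel] at this
        exact this
      rw [h2]
      have h3 : HasFDerivAt (fun y : Plane => y - x) (ContinuousLinearMap.id ℝ Plane) x :=
        (hasFDerivAt_id x).sub_const x
      exact ((L.linearIsometry.toContinuousLinearMap).hasFDerivAt.comp x h3).const_add _
    exact (hd x).unique h1
  · obtain ⟨x, rfl⟩ := Torus.surjective_proj q
    rw [← Torus.proj_add, ← h, hL, Torus.proj_add, h]

/-- The translation of the torus by the class of `a`. -/
def Torus.rotation (a : Plane) : Torus ≃ₘ⟮𝓘(ℝ, Plane), 𝓘(ℝ, Plane)⟯ Torus where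
  toEquiv := Equiv.addRight (Torus.proj a)
  contMDiff_toFun := by
    intro q
    set ℓ := Torus.isLocalHomeomorph_proj.localInverseAt q.out with hℓ
    have hsrc : q ∈ ℓ.source := by
      rw [← Torus.extChartAt_source]; exact mem_extChartAt_source _
    have h1 : ContMDiffAt 𝓘(ℝ, Plane) 𝓘(ℝ, Plane) ∞ (fun q => Torus.proj (ℓ q + a)) q := by
      have h2 : ContMDiff 𝓘(ℝ, Plane) 𝓘(ℝ, Plane) ∞ (fun w : Plane => w + a) :=
        (contDiff_id.add contDiff_const).contMDiff
      exact ((Torus.contMDiff_proj.comp h2) _).comp q (Torus.contMDiffAt_localInverse hsrc)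
    refine h1.congr_of_eventuallyEq ?_
    filter_upwards [ℓ.open_source.mem_nhds hsrc] with w hw
    rw [Torus.proj_add, hℓ, Torus.isLocalHomeomorph_proj.apply_localInverseAt_of_mem hw]
    rfl
  contMDiff_invFun := by
    intro q
    set ℓ := Torus.isLocalHomeomorph_proj.localInverseAt q.out with hℓ
    have hsrc : q ∈ ℓ.source := by
      rw [← Torus.extChartAt_source]; exact mem_extChartAt_source _
    have h1 : ContMDiffAt 𝓘(ℝ, Plane) 𝓘(ℝ, Plane) ∞ (fun q => Torus.proj (ℓ q + -a)) q := by
      have h2 : ContMDiff 𝓘(ℝ, Plane) 𝓘(ℝ, Plane) ∞ (fun w : Plane => w + -a) :=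
        (contDiff_id.add contDiff_const).contMDiff
      exact ((Torus.contMDiff_proj.comp h2) _).comp q (Torus.contMDiffAt_localInverse hsrc)
    refine h1.congr_of_eventuallyEq ?_
    filter_upwards [ℓ.open_source.mem_nhds hsrc] with w hw
    rw [Torus.proj_add, hℓ, Torus.isLocalHomeomorph_proj.apply_localInverseAt_of_mem hw]
    rfl

theorem Torus.rotation_apply (a : Plane) (q : Torus) :
    Torus.rotation a q = q + Torus.proj a := rfl

theorem Torus.rotation_iterate (a : Plane) (n : ℕ) (q : Torus) :
    (Torus.rotation a)^[n] q = q + n • Torus.proj a := by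
  induction n with
  | zero => simp
  | succ n ih => rw [Function.iterate_succ_apply', ih, Torus.rotation_apply, succ_nsmul, add_assoc]

theorem Torus.isFlatIsometry_rotation (a : Plane) : IsFlatIsometry (Torus.rotation a) := by
  intro q v
  obtain ⟨x, rfl⟩ := Torus.surjective_proj q
  have h1 := Torus.hasFDerivAt_lift (Torus.rotation a).contMDiff (Φ := fun w => w + a)
    (by fun_prop) (fun w => rfl) x
  rw [h1.unique ((hasFDerivAt_id x).add_const a)]
  rfl

theorem Torus.fixesNoClosedGeodesic_rotation {a : Plane}
    (ha : LinearIndependent ℚ ![(1 : ℝ), a 0, a 1]) :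
    FixesNoClosedGeodesic (Torus.rotation a) := by
  rintro n hn γ ⟨⟨x, v, hv, hγ⟩, hper⟩ heq
  have hvl : v ∈ lattice := by
    have h := hper 0
    rw [hγ, hγ, eq_comm, Torus.proj_eq_iff] at h
    simpa using h
  have hmem : (Torus.rotation a)^[n] (γ 0) ∈ range γ :=
    heq ▸ mem_image_of_mem _ (mem_range_self 0)
  obtain ⟨t, ht⟩ := hmem
  rw [Torus.rotation_iterate, hγ, hγ, zero_smul, add_zero,
    show n • Torus.proj a = Torus.proj (n • a) from rfl, ← Torus.proj_add,
    Torus.proj_eq_iff] at ht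
  obtain ⟨k₀, hk₀⟩ := ht 0
  obtain ⟨k₁, hk₁⟩ := ht 1
  obtain ⟨v₀, hv₀⟩ := hvl 0
  obtain ⟨v₁, hv₁⟩ := hvl 1
  simp [hv₀, hv₁] at hk₀ hk₁
  rw [LinearIndependent.iff_fractionRing (R := ℤ) (K := ℚ) |>.symm] at ha
  rw [Fintype.linearIndependent_iff] at ha
  have := ha ![k₁ * v₀ - k₀ * v₁, n * v₁, -(n * v₀)] (by
    simp [Fin.sum_univ_three]
    linear_combination (v₁ : ℝ) * hk₀ - v₀ * hk₁)
  have h1 := this 1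
  have h2 := this 2
  simp [hn.ne'] at h1 h2
  apply hv
  ext i
  fin_cases i
  · simp [hv₀, h2]
  · simp [hv₁, h1]

theorem linearIndependent_sqrt_two_three :
    LinearIndependent ℚ ![(1 : ℝ), √2, √3] := by
  rw [Fintype.linearIndependent_iff]
  intro g hg
  simp [Fin.sum_univ_three, Rat.smul_def] at hg
  have h2 : (√2 : ℝ) ^ 2 = 2 := Real.sq_sqrt (by norm_num)
  have h3 : (√3 : ℝ) ^ 2 = 3 := Real.sq_sqrt (by norm_num)
  have irr2 : Irrational √2 := irrational_sqrt_two
  have irr3 : Irrational √3 := by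
    have := Nat.Prime.irrational_sqrt (p := 3) (by norm_num)
    exact_mod_cast this
  have irr6 : Irrational √6 := by
    have : ¬ IsSquare (6 : ℕ) := by
      rintro ⟨r, hr⟩
      have : r < 3 := by nlinarith
      interval_cases r <;> omega
    have := irrational_sqrt_natCast_iff.mpr this
    exact_mod_cast this
  have h6 : √2 * √3 = √6 := by rw [← Real.sqrt_mul (by norm_num)]; norm_num
  have hbc : (g 1 * g 2 : ℚ) = 0 := by
    by_contra hne
    apply irr6
    refine ⟨(g 0 ^ 2 - 2 * g 1 ^ 2 - 3 * g 2 ^ 2) / (2 * (g 1 * g 2)), ?_⟩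
    push_cast
    have hne' : (g 1 : ℝ) * g 2 ≠ 0 := by exact_mod_cast hne
    rw [← h6, div_eq_iff (by simpa using hne')]
    linear_combination (g 0 - g 1 * √2 - g 2 * √3) * hg + (g 1 : ℝ) ^ 2 * h2 + (g 2 : ℝ) ^ 2 * h3
  have hb : g 1 = 0 := by
    rcases mul_eq_zero.mp hbc with h | h
    · exact h
    · by_contra hne
      apply irr2
      have hne' : (g 1 : ℝ) ≠ 0 := by exact_mod_cast hne
      refine ⟨-g 0 / g 1, ?_⟩
      push_cast
      rw [div_eq_iff hne']
      simp [h] at hg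
      linear_combination -hg
  have hcz : g 2 = 0 := by
    by_contra hne
    apply irr3
    have hne' : (g 2 : ℝ) ≠ 0 := by exact_mod_cast hne
    refine ⟨-g 0 / g 2, ?_⟩
    push_cast
    rw [div_eq_iff hne']
    simp [hb] at hg
    linear_combination -hg
  have h0 : g 0 = 0 := by simpa [hb, hcz] using hg
  intro i
  fin_cases i
  · exact h0
  · exact hb
  · exact hcz

namespace MappingTorus

variable {E : Type*} [NormedAddCommGroup E] [NormedSpace ℝ E]
  {H : Type*} [TopologicalSpace H] {I : ModelWithCorners ℝ E H}
  {C : Type*} [TopologicalSpace C] [ChartedSpace H C] (ψ : C ≃ₘ⟮I, I⟯ C)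

theorem surjective_proj : Function.Surjective (proj ψ) := (proj_out ψ).surjective

/-- The projection of the mapping torus to the circle `ℝ / ℤ`. -/
def angle : MappingTorus ψ → AddCircle (1 : ℝ) :=
  Quotient.lift (fun a : C × ℝ => (a.2 : AddCircle (1 : ℝ))) (by
    rintro a _ ⟨n, rfl⟩
    rw [eq_comm]
    simp [deck])

@[simp]
theorem angle_proj (a : C × ℝ) : angle ψ (proj ψ a) = (a.2 : AddCircle (1 : ℝ)) := rfl

theorem continuous_angle : Continuous (angle ψ) :=
  Continuous.quotient_lift ((AddCircle.continuous_mk' 1).comp continuous_snd) _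

theorem coe_eq_coe_iff {s t : ℝ} :
    (s : AddCircle (1 : ℝ)) = t ↔ ∃ n : ℤ, s + n = t := by
  rw [eq_comm, ← sub_eq_zero, ← AddCircle.coe_sub, AddCircle.coe_eq_zero_iff]
  simp [eq_sub_iff_add_eq, add_comm]

theorem exists_proj_of_angle_eq {m : MappingTorus ψ} {t : ℝ} (h : angle ψ m = t) :
    ∃ c, proj ψ (c, t) = m := by
  obtain ⟨a, rfl⟩ := surjective_proj ψ m
  obtain ⟨n, rfl⟩ := coe_eq_coe_iff.mp h
  exact ⟨_, congrFun (proj_deck ψ n) a⟩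

instance [T2Space C] : T2Space (MappingTorus ψ) := by
  refine ⟨fun m m' hne => ?_⟩
  by_cases h : angle ψ m = angle ψ m'
  · obtain ⟨⟨x, θ⟩, rfl⟩ := surjective_proj ψ m
    obtain ⟨y, rfl⟩ := exists_proj_of_angle_eq ψ h.symm
    have hxy : x ≠ y := by rintro rfl; exact hne rfl
    obtain ⟨U, V, hU, hV, hxU, hyV, hUV⟩ := t2_separation hxy
    refine ⟨_, _, isOpenMap_proj ψ _ (hU.prod (isOpen_ball : IsOpen (ball θ (1 / 2)))),
      isOpenMap_proj ψ _ (hV.prod (isOpen_ball : IsOpen (ball θ (1 / 2)))),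
      mem_image_of_mem _ ⟨hxU, mem_ball_self (by norm_num)⟩,
      mem_image_of_mem _ ⟨hyV, mem_ball_self (by norm_num)⟩, ?_⟩
    rw [Set.disjoint_left]
    rintro _ ⟨a, ⟨ha1, ha2⟩, rfl⟩ ⟨b, ⟨hb1, hb2⟩, hab⟩
    obtain ⟨n, hn⟩ := (proj_eq_iff ψ b a).mp hab
    have h1 : b.2 + n = a.2 := congrArg Prod.snd hn
    rw [mem_ball, Real.dist_eq, abs_lt] at ha2 hb2
    have hn1 : (n : ℝ) < 1 := by linarith
    have hn2 : (-1 : ℝ) < n := by linarith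
    have h3 : n < 1 := by exact_mod_cast hn1
    have h4 : -1 < n := by exact_mod_cast hn2
    obtain rfl : n = 0 := by omega
    rw [deck_zero] at hn
    subst hn
    exact Set.disjoint_left.mp hUV ha1 hb1
  · obtain ⟨U, V, hU, hV, hxU, hyV, hUV⟩ := t2_separation h
    exact ⟨_, _, hU.preimage (continuous_angle ψ), hV.preimage (continuous_angle ψ), hxU, hyV,
      hUV.preimage _⟩

instance [CompactSpace C] : CompactSpace (MappingTorus ψ) := by
  refine ⟨?_⟩
  have h : (univ : Set (MappingTorus ψ)) = proj ψ '' (univ ×ˢ Icc 0 1) := by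
    refine (eq_univ_of_forall fun m => ?_).symm
    obtain ⟨⟨x, θ⟩, rfl⟩ := surjective_proj ψ m
    obtain ⟨y, hy⟩ := exists_proj_of_angle_eq ψ (m := proj ψ (x, θ)) (t := Int.fract θ)
      (coe_eq_coe_iff.mpr ⟨-⌊θ⌋, by simp [Int.fract, sub_eq_add_neg]⟩)
    exact ⟨_, ⟨mem_univ _, Int.fract_nonneg θ, (Int.fract_lt_one θ).le⟩, hy⟩
  rw [h]
  exact (isCompact_univ.prod isCompact_Icc).image (continuous_proj ψ)

instance [ConnectedSpace C] : ConnectedSpace (MappingTorus ψ) :=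
  (surjective_proj ψ).connectedSpace (continuous_proj ψ)

theorem exists_smooth_deck (a b : C × ℝ) (h : proj ψ a = proj ψ b) :
    ∃ τ : C × ℝ → C × ℝ, ContMDiff (I.prod 𝓘(ℝ, ℝ)) (I.prod 𝓘(ℝ, ℝ)) ∞ τ ∧
      proj ψ ∘ τ = proj ψ ∧ τ a = b := by
  obtain ⟨n, hn⟩ := (proj_eq_iff ψ a b).mp h
  exact ⟨deck ψ n, contMDiff_deck ψ n, proj_deck ψ n, hn⟩

variable [IsManifold I ∞ C]

theorem contMDiff_proj : ContMDiff (I.prod 𝓘(ℝ, ℝ)) (I.prod 𝓘(ℝ, ℝ)) ∞ (proj ψ) :=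
  contMDiff_of_deck (isLocalHomeomorph_proj ψ) (proj_out ψ) (exists_smooth_deck ψ)

theorem contMDiffAt_localInverse {b : C × ℝ} {m : MappingTorus ψ}
    (hm : m ∈ ((isLocalHomeomorph_proj ψ).localInverseAt b).source) :
    ContMDiffAt (I.prod 𝓘(ℝ, ℝ)) (I.prod 𝓘(ℝ, ℝ)) ∞
      ((isLocalHomeomorph_proj ψ).localInverseAt b) m :=
  contMDiffAt_localInverse_of_deck (isLocalHomeomorph_proj ψ) (proj_out ψ) (exists_smooth_deck ψ)
    hm

theorem hasMFDerivAt_proj (a : C × ℝ) :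
    HasMFDerivAt (I.prod 𝓘(ℝ, ℝ)) (I.prod 𝓘(ℝ, ℝ)) (proj ψ) a
      (mfderiv (I.prod 𝓘(ℝ, ℝ)) (I.prod 𝓘(ℝ, ℝ)) (proj ψ) a) :=
  ((contMDiff_proj ψ).mdifferentiable (by simp) a).hasMFDerivAt

theorem exists_leftInverse_mfderiv_proj (a : C × ℝ) :
    ∃ L : E × ℝ →L[ℝ] E × ℝ,
      L.comp (mfderiv (I.prod 𝓘(ℝ, ℝ)) (I.prod 𝓘(ℝ, ℝ)) (proj ψ) a : E × ℝ →L[ℝ] E × ℝ) =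
        ContinuousLinearMap.id ℝ (E × ℝ) := by
  have hp := isLocalHomeomorph_proj ψ
  have hd := ((contMDiffAt_localInverse ψ (b := a)
    hp.apply_self_mem_localInverseAt_source).mdifferentiableAt (by simp)).hasMFDerivAt
  have hev : ∀ᶠ w in 𝓝 a, hp.localInverseAt a (proj ψ w) = w :=
    localInverse_comp_eventually (τ := id) hp hp.apply_self_mem_localInverseAt_source
      continuous_id rfl hp.localInverseAt_apply_self.symm
  have hc := (hd.comp a (hasMFDerivAt_proj ψ a)).congr_of_eventuallyEq
    (f₁ := id) (hev.mono fun w hw => hw.symm)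
  exact ⟨_, hasMFDerivAt_unique hc (hasMFDerivAt_id a)⟩

theorem injective_mfderiv_proj (a : C × ℝ) :
    Function.Injective (mfderiv (I.prod 𝓘(ℝ, ℝ)) (I.prod 𝓘(ℝ, ℝ)) (proj ψ) a) := by
  obtain ⟨L, hL⟩ := exists_leftInverse_mfderiv_proj ψ a
  exact Function.LeftInverse.injective (g := L) fun v => congrArg (fun A => A v) hL

theorem bijective_mfderiv_proj [FiniteDimensional ℝ E] (a : C × ℝ) :
    Function.Bijective (mfderiv (I.prod 𝓘(ℝ, ℝ)) (I.prod 𝓘(ℝ, ℝ)) (proj ψ) a) := by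
  let D : E × ℝ →L[ℝ] E × ℝ := mfderiv (I.prod 𝓘(ℝ, ℝ)) (I.prod 𝓘(ℝ, ℝ)) (proj ψ) a
  have hD : Function.Injective D.toLinearMap := injective_mfderiv_proj ψ a
  exact ⟨hD, (LinearMap.injective_iff_surjective (K := ℝ) (V := E × ℝ)
    (f := (D : E × ℝ →ₗ[ℝ] E × ℝ))).mp hD⟩

end MappingTorus

instance : ConnectedSpace (sphere (0 : Plane) 1) :=
  isConnected_iff_connectedSpace.mp
    (isConnected_sphere (by rw [← Module.finrank_eq_rank]; simp) 0 zero_le_one)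

section Pullback

variable {E : Type*} [NormedAddCommGroup E] [NormedSpace ℝ E]
  {H : Type*} [TopologicalSpace H] {I : ModelWithCorners ℝ E H}
  {M : Type*} [TopologicalSpace M] [ChartedSpace H M]
  {W : Type*} [NormedAddCommGroup W] [NormedSpace ℝ W]

/-- The differential of a map from a normed space to a manifold, in the trivialization of the
tangent space by the preferred chart. -/
def diffl (I : ModelWithCorners ℝ E H) (F : W → M) (y : W) : W →L[ℝ] E := mfderiv 𝓘(ℝ, W) I F y

/-- The value of a 1-form at a point, as a functional on the model vector space. -/
def OneForm.val (η : OneForm I M) (m : M) : E →L[ℝ] ℝ := η m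

/-- The pullback of a 1-form to a normed space. -/
def OneForm.pull (η : OneForm I M) (F : W → M) (y : W) : W →L[ℝ] ℝ :=
  (η.val (F y)).comp (diffl I F y)

theorem diffl_eq_fderiv {F : W → M} {y : W} (hF : MDifferentiableAt 𝓘(ℝ, W) I F y) :
    diffl I F y = fderiv ℝ (extChartAt I (F y) ∘ F) y := by
  have h : HasFDerivWithinAt (extChartAt I (F y) ∘ F) (diffl I F y) (range (id : W → W)) y :=
    hF.hasMFDerivAt.2
  rw [range_id, hasFDerivWithinAt_univ] at h
  exact h.fderiv.symm

variable [IsManifold I ∞ M]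

theorem contDiffAt_extChartAt_comp {F : W → M} {y : W} {x₀ : M}
    (hF : ContMDiffAt 𝓘(ℝ, W) I ∞ F y) (hy : F y ∈ (chartAt H x₀).source) :
    ContDiffAt ℝ ∞ (extChartAt I x₀ ∘ F) y :=
  (ContMDiffAt.comp y (contMDiffAt_extChartAt' (by exact hy)) hF).contDiffAt

/-- A map with bijective differential has local sections. -/
theorem exists_local_section [CompleteSpace W] [CompleteSpace E] {F : W → M}
    (hF : ContMDiff 𝓘(ℝ, W) I ∞ F) (hbij : ∀ y, Function.Bijective (diffl I F y)) (y : W) :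
    ∃ k : M → W, k (F y) = y ∧
      ∀ᶠ m in 𝓝 (F y), ContMDiffAt I 𝓘(ℝ, W) ∞ k m ∧ F (k m) = m := by
  have hgs : ContDiffAt ℝ ∞ (extChartAt I (F y) ∘ F) y :=
    contDiffAt_extChartAt_comp (hF y) (mem_chart_source H (F y))
  let A : W ≃L[ℝ] E := ContinuousLinearEquiv.ofBijective (diffl I F y)
    (LinearMap.ker_eq_bot.mpr (hbij y).1) (LinearMap.range_eq_top.mpr (hbij y).2)
  have hA : HasFDerivAt (extChartAt I (F y) ∘ F) (A : W →L[ℝ] E) y := by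
    have := (hgs.differentiableAt (by simp)).hasFDerivAt
    rw [← diffl_eq_fderiv (hF.mdifferentiable (by simp) y)] at this
    exact this
  set g := extChartAt I (F y) ∘ F with hg
  set ψ := hgs.toOpenPartialHomeomorph g hA (by simp) with hψ
  have hψc : ⇑ψ = g := hgs.toOpenPartialHomeomorph_coe hA (by simp)
  have hyψ : y ∈ ψ.source := hgs.mem_toOpenPartialHomeomorph_source hA (by simp)
  have hsymm : ψ.symm (g y) = y := by rw [← hψc]; exact ψ.left_inv hyψ
  have hgy : g y ∈ ψ.target := by rw [← hψc]; exact ψ.map_source hyψ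
  have h1 : ∀ᶠ w in 𝓝 y, F w ∈ (chartAt H (F y)).source :=
    hF.continuous.continuousAt.eventually_mem
      ((chartAt H (F y)).open_source.mem_nhds (mem_chart_source H (F y)))
  have h2 : ∀ᶠ w in 𝓝 y, fderiv ℝ g w ∈ range ((↑) : (W ≃L[ℝ] E) → W →L[ℝ] E) := by
    have hc : ContinuousAt (fderiv ℝ g) y :=
      (hgs.fderiv_right (m := ∞) le_rfl).continuousAt
    refine hc.eventually_mem ?_
    rw [hA.fderiv]
    exact ContinuousLinearEquiv.nhds A
  have hcont : Filter.Tendsto ψ.symm (𝓝 (g y)) (𝓝 y) := by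
    have := ψ.continuousAt_symm hgy
    rwa [ContinuousAt, hsymm] at this
  have h3 : ∀ᶠ e in 𝓝 (g y), ContDiffAt ℝ ∞ ψ.symm e ∧ F (ψ.symm e) ∈ (chartAt H (F y)).source ∧
      g (ψ.symm e) = e := by
    filter_upwards [hcont.eventually h1, hcont.eventually h2, ψ.open_target.mem_nhds hgy]
      with e he1 he2 he3
    obtain ⟨B, hB⟩ := he2
    have hge : ContDiffAt ℝ ∞ g (ψ.symm e) := contDiffAt_extChartAt_comp (hF _) he1
    refine ⟨ψ.contDiffAt_symm he3 (f₀' := B) ?_ (by rw [hψc]; exact hge), he1, ?_⟩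
    · rw [hψc, hB]
      exact (hge.differentiableAt (by simp)).hasFDerivAt
    · rw [← hψc]; exact ψ.right_inv he3
  refine ⟨ψ.symm ∘ extChartAt I (F y), hsymm, ?_⟩
  filter_upwards [(continuousAt_extChartAt (I := I) (F y)).eventually h3,
    (chartAt H (F y)).open_source.mem_nhds (mem_chart_source H (F y))] with m ⟨hm1, hm2, hm3⟩ hm4
  refine ⟨hm1.contMDiffAt.comp m (contMDiffAt_extChartAt' hm4), ?_⟩
  rw [← extChartAt_source I] at hm2 hm4
  exact (extChartAt I (F y)).injOn hm2 hm4 hm3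

variable [I.Boundaryless]

theorem mdifferentiableAt_extChartAt_symm' {x₀ : M} {e : E} (he : e ∈ (extChartAt I x₀).target) :
    MDifferentiableAt 𝓘(ℝ, E) I (extChartAt I x₀).symm e := by
  have := (contMDiffWithinAt_extChartAt_symm_range (n := ∞) x₀ he).mdifferentiableWithinAt
    (by simp)
  rwa [I.range_eq_univ, mdifferentiableWithinAt_univ] at this

theorem OneForm.pull_eq_inChart (η : OneForm I M) {F : W → M} {y : W} {x₀ : M}
    (hF : MDifferentiableAt 𝓘(ℝ, W) I F y) (hy : F y ∈ (chartAt H x₀).source) :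
    η.pull F y = (η.inChart x₀ (extChartAt I x₀ (F y))).comp
      (fderiv ℝ (extChartAt I x₀ ∘ F) y) := by
  have hsrc : F y ∈ (extChartAt I x₀).source := by rwa [extChartAt_source]
  have hs : HasMFDerivAt 𝓘(ℝ, E) I (extChartAt I x₀).symm (extChartAt I x₀ (F y))
      (mfderiv 𝓘(ℝ, E) I (extChartAt I x₀).symm (extChartAt I x₀ (F y))) :=
    (mdifferentiableAt_extChartAt_symm' ((extChartAt I x₀).map_source hsrc)).hasMFDerivAt
  have hg : HasMFDerivAt 𝓘(ℝ, W) 𝓘(ℝ, E) (extChartAt I x₀ ∘ F) y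
      (mfderiv 𝓘(ℝ, W) 𝓘(ℝ, E) (extChartAt I x₀ ∘ F) y) :=
    ((mdifferentiableAt_extChartAt hy).comp y hF).hasMFDerivAt
  have hev : F =ᶠ[𝓝 y] (extChartAt I x₀).symm ∘ (extChartAt I x₀ ∘ F) := by
    filter_upwards [hF.continuousAt.eventually_mem
      ((isOpen_extChartAt_source x₀).mem_nhds hsrc)] with w hw
    exact ((extChartAt I x₀).left_inv hw).symm
  have h := (hs.comp y hg).congr_of_eventuallyEq hev
  have h1 : diffl I F y = (mfderiv 𝓘(ℝ, E) I (extChartAt I x₀).symm (extChartAt I x₀ (F y)) :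
      E →L[ℝ] E).comp (fderiv ℝ (extChartAt I x₀ ∘ F) y) := by
    have := h.mfderiv
    rw [mfderiv_eq_fderiv] at this
    exact this
  rw [OneForm.pull, h1, ← congrArg η.val ((extChartAt I x₀).left_inv hsrc)]
  rfl

/-- Naturality of the exterior derivative of 1-forms, for maps from a normed space. -/
theorem OneForm.d_diffl (η : OneForm I M) (hη : η.IsSmooth) {F : W → M}
    (hF : ContMDiff 𝓘(ℝ, W) I ∞ F) (y v w : W) :
    η.d (F y) (diffl I F y v) (diffl I F y w) =
      fderiv ℝ (η.pull F) y v w - fderiv ℝ (η.pull F) y w v := by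
  set g := extChartAt I (F y) ∘ F with hg
  have hgs : ContDiffAt ℝ ∞ g y := contDiffAt_extChartAt_comp (hF y) (mem_chart_source H (F y))
  set ζ : E → E →L[ℝ] ℝ := η.inChart (F y)
  have hζ : DifferentiableAt ℝ ζ (g y) :=
    ((hη (F y)).contDiffAt (extChartAt_target_mem_nhds (F y))).differentiableAt (by simp)
  have hev : η.pull F =ᶠ[𝓝 y] fun y' => (ζ (g y')).comp (fderiv ℝ g y') := by
    filter_upwards [(hF.continuous.continuousAt (x := y)).eventually_mem
      ((chartAt H (F y)).open_source.mem_nhds (mem_chart_source H (F y)))] with y' hy'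
    exact η.pull_eq_inChart (hF.mdifferentiable (by simp) y') hy'
  have hg1 : HasFDerivAt g (fderiv ℝ g y) y := (hgs.differentiableAt (by simp)).hasFDerivAt
  have hg2 : HasFDerivAt (fderiv ℝ g) (fderiv ℝ (fderiv ℝ g) y) y :=
    ((hgs.fderiv_right (m := ∞) le_rfl).differentiableAt
      (by simp)).hasFDerivAt
  have hd := ((hζ.hasFDerivAt.comp y hg1).clm_comp hg2).congr_of_eventuallyEq hev
  have hsymm : fderiv ℝ (fderiv ℝ g) y v w = fderiv ℝ (fderiv ℝ g) y w v :=
    hgs.isSymmSndFDerivAt (by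
      rw [minSmoothness_of_isRCLikeNormedField]; exact WithTop.coe_le_coe.mpr le_top) v w
  rw [hd.fderiv, diffl_eq_fderiv (hF.mdifferentiable (by simp) y)]
  simp [OneForm.d, hsymm]
  rfl

/-- A 1-form is smooth if its pullback by a surjective local diffeomorphism is smooth. -/
theorem OneForm.isSmooth_of_pull [CompleteSpace W] [CompleteSpace E] (η : OneForm I M) {F : W → M}
    (hF : ContMDiff 𝓘(ℝ, W) I ∞ F) (hbij : ∀ y, Function.Bijective (diffl I F y))
    (hsurj : Function.Surjective F) (hη : ContDiff ℝ ∞ (η.pull F)) : η.IsSmooth := by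
  intro x₀ e he
  obtain ⟨y, hy⟩ := hsurj ((extChartAt I x₀).symm e)
  obtain ⟨k, hky, hk⟩ := exists_local_section hF hbij y
  set c := (extChartAt I x₀).symm with hc
  have hcs : ∀ᶠ e' in 𝓝 e, ContMDiffAt 𝓘(ℝ, E) I ∞ c e' := by
    filter_upwards [(isOpen_extChartAt_target x₀).mem_nhds he] with e' he'
    have := contMDiffWithinAt_extChartAt_symm_range (I := I) (n := ∞) x₀ he'
    rwa [I.range_eq_univ, contMDiffWithinAt_univ] at this
  have hev : ∀ᶠ e' in 𝓝 e, ContDiffAt ℝ ∞ (k ∘ c) e' ∧ F (k (c e')) = c e' ∧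
      ContMDiffAt 𝓘(ℝ, E) I ∞ c e' := by
    rw [hy] at hk
    filter_upwards [hcs, (hcs.self_of_nhds.continuousAt).eventually hk] with e' h1 h2
    exact ⟨(h2.1.comp e' h1).contDiffAt, h2.2, h1⟩
  have hsmooth := hev.self_of_nhds.1
  have hform : ContDiffAt ℝ ∞
      (fun e' => (η.pull F (k (c e'))).comp (fderiv ℝ (k ∘ c) e')) e :=
    (hη.contDiffAt.comp e hsmooth).clm_comp (hsmooth.fderiv_right le_rfl)
  refine (hform.congr_of_eventuallyEq ?_).contDiffWithinAt
  filter_upwards [hev.eventually_nhds] with e' he'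
  obtain ⟨h1, h2, h3⟩ := he'.self_of_nhds
  have hd : HasMFDerivAt 𝓘(ℝ, E) I (F ∘ (k ∘ c)) e'
      ((diffl I F (k (c e'))).comp (fderiv ℝ (k ∘ c) e')) :=
    ((hF.mdifferentiable (by simp) (k (c e'))).hasMFDerivAt).comp e'
      ((h1.differentiableAt (by simp)).hasFDerivAt.hasMFDerivAt)
  have hd' := (hd.congr_of_eventuallyEq (f₁ := c) (he'.mono fun w hw => hw.2.1.symm)).mfderiv
  rw [OneForm.inChart, OneForm.pull, h2, ← hc, hd']
  rfl

end Pullback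

section Preserves

variable {E : Type*} [NormedAddCommGroup E] [NormedSpace ℝ E]
  {H : Type*} [TopologicalSpace H] {I : ModelWithCorners ℝ E H}
  {C : Type*} [TopologicalSpace C] [ChartedSpace H C]

/-- The smooth map `f` preserves the 1-form `η`. -/
def Preserves (η : OneForm I C) (f : C → C) : Prop :=
  ContMDiff I I ∞ f ∧ ∀ c (v : TangentSpace I c), η (f c) (mfderiv I I f c v) = η c v

theorem Preserves.comp {η : OneForm I C} {f g : C → C} (hf : Preserves η f)
    (hg : Preserves η g) : Preserves η (f ∘ g) := by
  refine ⟨hf.1.comp hg.1, fun c v => ?_⟩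
  rw [mfderiv_comp c (hf.1.mdifferentiable (by simp) _) (hg.1.mdifferentiable (by simp) _)]
  exact (hf.2 _ _).trans (hg.2 _ _)

theorem Preserves.symm {η : OneForm I C} {ψ : C ≃ₘ⟮I, I⟯ C} (h : Preserves η ψ) :
    Preserves η ψ.symm := by
  refine ⟨ψ.symm.contMDiff, fun c v => ?_⟩
  rw [← h.2]
  have h1 := mfderiv_comp c (ψ.contMDiff.mdifferentiable (by simp) (ψ.symm c))
    (ψ.symm.contMDiff.mdifferentiable (by simp) c)
  have h2 : ψ ∘ ψ.symm = id := by ext1 x; simp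
  rw [h2, mfderiv_id] at h1
  have h3 : mfderiv I I ψ (ψ.symm c) (mfderiv I I ψ.symm c v) = v :=
    (congrArg (fun A : E →L[ℝ] E => A v) h1).symm
  rw [h3]
  exact congrArg (fun m => η.val m v) (ψ.apply_symm_apply c)

theorem Preserves.zpow {η : OneForm I C} {ψ : C ≃ₘ⟮I, I⟯ C} (h : Preserves η ψ) (n : ℤ) :
    Preserves η ((ψ.toEquiv ^ n : Equiv.Perm C) : C → C) := by
  have hnat : ∀ (χ : C ≃ₘ⟮I, I⟯ C), Preserves η χ → ∀ k : ℕ,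
      Preserves η ((χ.toEquiv ^ k : Equiv.Perm C) : C → C) := by
    intro χ hχ k
    induction k with
    | zero =>
      refine ⟨contMDiff_id, fun c v => ?_⟩
      rw [pow_zero, Equiv.Perm.coe_one, mfderiv_id]
      rfl
    | succ k ih =>
      rw [pow_succ]
      exact ih.comp hχ
  cases n with
  | ofNat k => simpa using hnat ψ h k
  | negSucc k =>
    have : (ψ.toEquiv ^ Int.negSucc k : Equiv.Perm C) = ψ.symm.toEquiv ^ (k + 1) := by
      rw [zpow_negSucc, ← inv_pow]; rfl
    rw [this]
    exact hnat ψ.symm h.symm (k + 1)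

namespace MappingTorus

variable (ψ : C ≃ₘ⟮I, I⟯ C)

/-- The form descended from a deck-invariant 1-form `η` pulls back to `η`. -/
theorem descend_mfderiv_proj [IsManifold I ∞ C] [FiniteDimensional ℝ E]
    {η : OneForm (I.prod 𝓘(ℝ, ℝ)) (C × ℝ)} (hη : ∀ n : ℤ, Preserves η (deck ψ n))
    (a : C × ℝ) (v : E × ℝ) :
    descend ψ η (proj ψ a) (mfderiv (I.prod 𝓘(ℝ, ℝ)) (I.prod 𝓘(ℝ, ℝ)) (proj ψ) a v) = η a v := by
  obtain ⟨n, hn⟩ := (proj_eq_iff ψ a (proj ψ a).out).mp (proj_out ψ _).symm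
  have h1 := mfderiv_comp a ((contMDiff_proj ψ).mdifferentiable (by simp) (deck ψ n a))
    ((hη n).1.mdifferentiable (by simp) a)
  rw [proj_deck] at h1
  rw [← (hη n).2 a v, h1]
  let w : E × ℝ := mfderiv (I.prod 𝓘(ℝ, ℝ)) (I.prod 𝓘(ℝ, ℝ)) (deck ψ n) a v
  change η.val (proj ψ a).out ((mfderiv (I.prod 𝓘(ℝ, ℝ)) (I.prod 𝓘(ℝ, ℝ)) (proj ψ)
    (proj ψ a).out : E × ℝ →L[ℝ] E × ℝ).inverse ((mfderiv (I.prod 𝓘(ℝ, ℝ)) (I.prod 𝓘(ℝ, ℝ))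
      (proj ψ) (deck ψ n a) : E × ℝ →L[ℝ] E × ℝ) w)) = η.val (deck ψ n a) w
  rw [← hn]
  let D : E × ℝ →L[ℝ] E × ℝ := mfderiv (I.prod 𝓘(ℝ, ℝ)) (I.prod 𝓘(ℝ, ℝ)) (proj ψ) (deck ψ n a)
  have hD : Function.Bijective D := bijective_mfderiv_proj ψ (deck ψ n a)
  have hinv : D.IsInvertible :=
    ⟨ContinuousLinearEquiv.ofBijective D (LinearMap.ker_eq_bot.mpr hD.1)
      (LinearMap.range_eq_top.mpr hD.2), rfl⟩
  exact congrArg _ (hinv.inverse_apply_self w)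

theorem preserves_deck_alpha [IsManifold I ∞ C] (n : ℤ) :
    Preserves (I := I.prod 𝓘(ℝ, ℝ)) (fun a : C × ℝ => mfderiv (I.prod 𝓘(ℝ, ℝ)) 𝓘(ℝ, ℝ) Prod.snd a)
      (deck ψ n) := by
  refine ⟨contMDiff_deck ψ n, fun a v => ?_⟩
  have h1 := mfderiv_comp a (contMDiff_snd.mdifferentiable (n := ∞) (by simp) (deck ψ n a) :
      MDifferentiableAt (I.prod 𝓘(ℝ, ℝ)) 𝓘(ℝ, ℝ) Prod.snd (deck ψ n a))
    ((contMDiff_deck ψ n).mdifferentiable (by simp) a)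
  have h2 : HasMFDerivAt (I.prod 𝓘(ℝ, ℝ)) 𝓘(ℝ, ℝ) (Prod.snd ∘ deck ψ n) a
      (ContinuousLinearMap.snd ℝ E ℝ) := by
    have h3 : HasMFDerivAt 𝓘(ℝ, ℝ) 𝓘(ℝ, ℝ) (fun t : ℝ => t + n) a.2
        (ContinuousLinearMap.id ℝ ℝ) := ((hasFDerivAt_id a.2).add_const (n : ℝ)).hasMFDerivAt
    exact h3.comp a (hasMFDerivAt_snd a)
  rw [h2.mfderiv] at h1
  have h3 := congrArg (fun A : E × ℝ →L[ℝ] ℝ => A v) h1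
  have h4 : mfderiv (I.prod 𝓘(ℝ, ℝ)) 𝓘(ℝ, ℝ) Prod.snd a v = v.2 := by rw [mfderiv_snd]; rfl
  exact h3.symm.trans h4.symm

theorem preserves_deck_lam [IsManifold I ∞ C] {η : OneForm I C} (hη : Preserves η ψ) (n : ℤ) :
    Preserves (I := I.prod 𝓘(ℝ, ℝ))
      (fun a : C × ℝ => (η a.1).comp (mfderiv (I.prod 𝓘(ℝ, ℝ)) I Prod.fst a)) (deck ψ n) := by
  refine ⟨contMDiff_deck ψ n, fun a v => ?_⟩
  have h1 := mfderiv_comp a (contMDiff_fst.mdifferentiable (n := ∞) (by simp) (deck ψ n a) :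
      MDifferentiableAt (I.prod 𝓘(ℝ, ℝ)) I Prod.fst (deck ψ n a))
    ((contMDiff_deck ψ n).mdifferentiable (by simp) a)
  have h2 : HasMFDerivAt (I.prod 𝓘(ℝ, ℝ)) I (Prod.fst ∘ deck ψ n) a
      ((mfderiv I I ((ψ.toEquiv ^ n : Equiv.Perm C) : C → C) a.1 : E →L[ℝ] E).comp
        (ContinuousLinearMap.fst ℝ E ℝ)) :=
    ((contMDiff_zpow ψ n).mdifferentiable (by simp) a.1).hasMFDerivAt.comp a (hasMFDerivAt_fst a)
  rw [h2.mfderiv] at h1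
  have h3 := congrArg (fun A : E × ℝ →L[ℝ] E => η.val (deck ψ n a).1 (A v)) h1
  have h4 : (η a.1).comp (mfderiv (I.prod 𝓘(ℝ, ℝ)) I Prod.fst a) v = η a.1 v.1 := by
    rw [mfderiv_fst]; rfl
  refine h3.symm.trans (Eq.trans ?_ h4.symm)
  exact (hη.zpow n).2 a.1 v.1

theorem alpha_mfderiv_proj [IsManifold I ∞ C] [FiniteDimensional ℝ E] (a : C × ℝ) (v : E × ℝ) :
    alpha ψ (proj ψ a) (mfderiv (I.prod 𝓘(ℝ, ℝ)) (I.prod 𝓘(ℝ, ℝ)) (proj ψ) a v) = v.2 := by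
  refine (descend_mfderiv_proj ψ (preserves_deck_alpha ψ) a v).trans ?_
  rw [mfderiv_snd]; rfl

theorem lam_mfderiv_proj [IsManifold I ∞ C] [FiniteDimensional ℝ E] {η : OneForm I C}
    (hη : Preserves η ψ) (a : C × ℝ) (v : E × ℝ) :
    lam ψ η (proj ψ a) (mfderiv (I.prod 𝓘(ℝ, ℝ)) (I.prod 𝓘(ℝ, ℝ)) (proj ψ) a v) =
      η.val a.1 v.1 := by
  refine (descend_mfderiv_proj ψ (preserves_deck_lam ψ hη) a v).trans ?_
  rw [mfderiv_fst]; rfl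

end MappingTorus

end Preserves

theorem preserves_liouville {φ : Torus ≃ₘ⟮𝓘(ℝ, Plane), 𝓘(ℝ, Plane)⟯ Torus}
    (hφ : IsFlatIsometry φ) : Preserves liouville (unitCotangentLift φ hφ) := by
  obtain ⟨A, hA, -⟩ := hφ.exists_affine
  refine ⟨(unitCotangentLift φ hφ).contMDiff, fun c v => ?_⟩
  have h1 := mfderiv_comp c (contMDiff_fst.mdifferentiable (n := ∞) (by simp) _ :
      MDifferentiableAt UnitCotangent.model 𝓘(ℝ, Plane) (Prod.fst : UnitCotangent → Torus)
        (unitCotangentLift φ hφ c))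
    ((unitCotangentLift φ hφ).contMDiff.mdifferentiable (by simp) c)
  have h2 : HasMFDerivAt UnitCotangent.model 𝓘(ℝ, Plane)
      (Prod.fst ∘ unitCotangentLift φ hφ) c
      ((Torus.deriv φ c.1).comp (ContinuousLinearMap.fst ℝ Plane (EuclideanSpace ℝ (Fin 1)))) :=
    (φ.contMDiff.mdifferentiable (by simp) c.1).hasMFDerivAt.comp c (hasMFDerivAt_fst c)
  rw [h2.mfderiv, hA] at h1
  have h3 := congrArg (fun B : Plane × EuclideanSpace ℝ (Fin 1) →L[ℝ] Plane =>
    inner ℝ (A c.2 : Plane) (B v)) h1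
  have h4 : liouville c v = inner ℝ (c.2 : Plane) v.1 := by
    rw [liouville, mfderiv_fst]; rfl
  have h5 : ((unitCotangentLift φ hφ c).2 : Plane) = A c.2 := by
    change Torus.deriv φ c.1 c.2 = _
    rw [hA]; rfl
  rw [h4, ← A.inner_map_map, ← h5]
  rw [← h5] at h3
  exact h3.symm

/-- The unit vector with angle `s`. -/
def dir (s : ℝ) : Plane := !₂[Real.cos s, Real.sin s]

/-- The unit vector with angle `s + π / 2`. -/
def nrm (s : ℝ) : Plane := !₂[-Real.sin s, Real.cos s]

theorem inner_plane (v w : Plane) : inner ℝ v w = v 0 * w 0 + v 1 * w 1 := by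
  simp [PiLp.inner_apply, Fin.sum_univ_two, mul_comm]

theorem inner_dir (s : ℝ) (v : Plane) :
    inner ℝ (dir s) v = Real.cos s * v 0 + Real.sin s * v 1 := by
  simp [inner_plane, dir]

theorem inner_nrm (s : ℝ) (v : Plane) :
    inner ℝ (nrm s) v = -Real.sin s * v 0 + Real.cos s * v 1 := by
  simp [inner_plane, nrm]

theorem inner_dir_dir (s : ℝ) : inner ℝ (dir s) (dir s) = (1 : ℝ) := by
  rw [inner_dir]; simp [dir]; nlinarith [Real.sin_sq_add_cos_sq s]

theorem inner_nrm_nrm (s : ℝ) : inner ℝ (nrm s) (nrm s) = (1 : ℝ) := by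
  rw [inner_nrm]; simp [nrm]; nlinarith [Real.sin_sq_add_cos_sq s]

theorem inner_nrm_dir (s : ℝ) : inner ℝ (nrm s) (dir s) = (0 : ℝ) := by
  rw [inner_nrm]; simp [dir]; ring

theorem inner_dir_nrm (s : ℝ) : inner ℝ (dir s) (nrm s) = (0 : ℝ) := by
  rw [inner_dir]; simp [nrm]; ring

theorem norm_dir (s : ℝ) : ‖dir s‖ = 1 := by
  rw [norm_eq_sqrt_real_inner, inner_dir_dir, Real.sqrt_one]

theorem dir_ne_zero (s : ℝ) : dir s ≠ 0 := by
  intro h; simpa [h] using norm_dir s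

theorem nrm_ne_zero (s : ℝ) : nrm s ≠ 0 := by
  intro h; simpa [h] using inner_nrm_nrm s

theorem eq_smul_dir (s : ℝ) {v : Plane} (h : inner ℝ (nrm s) v = (0 : ℝ)) :
    v = (inner ℝ (dir s) v : ℝ) • dir s := by
  rw [inner_nrm] at h
  rw [inner_dir]
  have := Real.sin_sq_add_cos_sq s
  ext i
  fin_cases i
  · simp [dir]
    linear_combination (-v 0) * this - Real.sin s * h
  · simp [dir]
    linear_combination (-v 1) * this + Real.cos s * h

theorem hasFDerivAt_dir (s : ℝ) :
    HasFDerivAt dir ((1 : ℝ →L[ℝ] ℝ).smulRight (nrm s)) s := by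
  rw [← hasFDerivWithinAt_univ, hasFDerivWithinAt_euclidean]
  intro i
  rw [hasFDerivWithinAt_univ]
  fin_cases i
  · refine (Real.hasDerivAt_cos s).hasFDerivAt.congr_fderiv ?_
    ext; simp [nrm]
  · refine (Real.hasDerivAt_sin s).hasFDerivAt.congr_fderiv ?_
    ext; simp [nrm]

theorem contDiff_dir : ContDiff ℝ ∞ dir := by
  rw [contDiff_euclidean]
  intro i
  fin_cases i
  · simpa [dir] using Real.contDiff_cos
  · simpa [dir] using Real.contDiff_sin

/-- The point of the unit circle with angle `s`. -/
def circlePt (s : ℝ) : sphere (0 : Plane) 1 :=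
  ⟨dir s, mem_sphere_zero_iff_norm.mpr (norm_dir s)⟩

theorem contMDiff_circlePt : ContMDiff 𝓘(ℝ, ℝ) (𝓡 1) ∞ circlePt :=
  contDiff_dir.contMDiff.codRestrict_sphere _

theorem surjective_circlePt : Function.Surjective circlePt := by
  rintro ⟨v, hv⟩
  rw [mem_sphere_zero_iff_norm, EuclideanSpace.norm_eq, Real.sqrt_eq_one] at hv
  simp only [Fin.sum_univ_two, Real.norm_eq_abs, sq_abs] at hv
  let z : ℂ := ⟨v 0, v 1⟩
  have hz : ‖z‖ = 1 := by
    rw [Complex.norm_def, Complex.normSq_apply, Real.sqrt_eq_one]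
    simp only [z]; linarith
  refine ⟨z.arg, Subtype.ext ?_⟩
  have hz0 : z ≠ 0 := by intro h; simp [h] at hz
  ext i
  fin_cases i
  · simp [circlePt, dir, Complex.cos_arg hz0, hz, z]
  · simp [circlePt, dir, Complex.sin_arg, hz, z]

/-- The parameter space `(x, s, θ)` of the unit cotangent mapping tori. -/
abbrev Param : Type := (Plane × ℝ) × ℝ

/-- The parametrization `(x, s, θ) ↦ ((x, (cos s, sin s)), θ)` of `C × ℝ`. -/
def paramCover (y : Param) : UnitCotangent × ℝ := ((Torus.proj y.1.1, circlePt y.1.2), y.2)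

/-- The differential of the parametrization of the circle. -/
def circleDiff (s : ℝ) : ℝ →L[ℝ] EuclideanSpace ℝ (Fin 1) := mfderiv 𝓘(ℝ, ℝ) (𝓡 1) circlePt s

theorem injective_circleDiff (s : ℝ) : Function.Injective (circleDiff s) := by
  have h1 : HasMFDerivAt 𝓘(ℝ, ℝ) (𝓡 1) circlePt s (circleDiff s) :=
    (contMDiff_circlePt.mdifferentiable (by simp) s).hasMFDerivAt
  have h2 := ((contMDiff_coe_sphere (n := 1) (E := Plane) (m := ∞)).mdifferentiable (by simp)
    (circlePt s)).hasMFDerivAt.comp s h1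
  have h3 := hasMFDerivAt_unique h2 (hasFDerivAt_dir s).hasMFDerivAt
  intro a b hab
  have h4 : (((1 : ℝ →L[ℝ] ℝ).smulRight (nrm s)) a : Plane) =
      ((1 : ℝ →L[ℝ] ℝ).smulRight (nrm s)) b := by
    rw [← show _ = ((1 : ℝ →L[ℝ] ℝ).smulRight (nrm s)) from h3]
    exact congrArg (mfderiv (𝓡 1) 𝓘(ℝ, Plane) ((↑) : sphere (0 : Plane) 1 → Plane) (circlePt s)) hab
  simp only [ContinuousLinearMap.smulRight_apply, one_apply_eq_self] at h4
  exact smul_left_injective ℝ (nrm_ne_zero s) h4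

theorem contMDiff_paramCover :
    ContMDiff 𝓘(ℝ, Param) (UnitCotangent.model.prod 𝓘(ℝ, ℝ)) ∞ paramCover := by
  have h1 : ContMDiff 𝓘(ℝ, Param) 𝓘(ℝ, Plane) ∞ (fun y : Param => y.1.1) :=
    (contDiff_fst.comp contDiff_fst).contMDiff
  have h2 : ContMDiff 𝓘(ℝ, Param) 𝓘(ℝ, ℝ) ∞ (fun y : Param => y.1.2) :=
    (contDiff_snd.comp contDiff_fst).contMDiff
  have h3 : ContMDiff 𝓘(ℝ, Param) 𝓘(ℝ, ℝ) ∞ (fun y : Param => y.2) := contDiff_snd.contMDiff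
  exact ((Torus.contMDiff_proj.comp h1).prodMk (contMDiff_circlePt.comp h2)).prodMk h3

/-- The differential of `paramCover`. -/
def paramDiff (y : Param) : Param →L[ℝ] (Plane × EuclideanSpace ℝ (Fin 1)) × ℝ :=
  ((ContinuousLinearMap.id ℝ Plane).prodMap (circleDiff y.1.2)).prodMap (ContinuousLinearMap.id ℝ ℝ)

theorem hasMFDerivAt_paramCover (y : Param) :
    HasMFDerivAt 𝓘(ℝ, Param) (UnitCotangent.model.prod 𝓘(ℝ, ℝ)) paramCover y (paramDiff y) := by
  have h1 : HasMFDerivAt 𝓘(ℝ, Param) 𝓘(ℝ, Plane) (fun y : Param => y.1.1) y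
      ((ContinuousLinearMap.fst ℝ Plane ℝ).comp (ContinuousLinearMap.fst ℝ (Plane × ℝ) ℝ)) :=
    (hasFDerivAt_fst.comp y hasFDerivAt_fst).hasMFDerivAt
  have h2 : HasMFDerivAt 𝓘(ℝ, Param) 𝓘(ℝ, ℝ) (fun y : Param => y.1.2) y
      ((ContinuousLinearMap.snd ℝ Plane ℝ).comp (ContinuousLinearMap.fst ℝ (Plane × ℝ) ℝ)) :=
    (hasFDerivAt_snd.comp y hasFDerivAt_fst).hasMFDerivAt
  have h3 : HasMFDerivAt 𝓘(ℝ, Param) 𝓘(ℝ, ℝ) (fun y : Param => y.2) y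
      (ContinuousLinearMap.snd ℝ (Plane × ℝ) ℝ) := hasFDerivAt_snd.hasMFDerivAt
  have h4 : HasMFDerivAt 𝓘(ℝ, ℝ) (𝓡 1) circlePt y.1.2 (circleDiff y.1.2) :=
    (contMDiff_circlePt.mdifferentiable (by simp) y.1.2).hasMFDerivAt
  exact (((Torus.hasMFDerivAt_proj y.1.1).comp y h1).prodMk (h4.comp y h2)).prodMk h3

section Lift

variable (ψ : UnitCotangent ≃ₘ⟮UnitCotangent.model, UnitCotangent.model⟯ UnitCotangent)

/-- The parametrization of the mapping torus by `(x, s, θ)`. -/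
def param (y : Param) : MappingTorus ψ := MappingTorus.proj ψ (paramCover y)

theorem surjective_paramCover : Function.Surjective paramCover := by
  rintro ⟨⟨q, p⟩, θ⟩
  obtain ⟨x, rfl⟩ := Torus.surjective_proj q
  obtain ⟨s, rfl⟩ := surjective_circlePt p
  exact ⟨((x, s), θ), rfl⟩

theorem surjective_param : Function.Surjective (param ψ) :=
  (MappingTorus.surjective_proj ψ).comp surjective_paramCover

theorem contMDiff_param :
    ContMDiff 𝓘(ℝ, Param) (UnitCotangent.model.prod 𝓘(ℝ, ℝ)) ∞ (param ψ) :=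
  (MappingTorus.contMDiff_proj ψ).comp contMDiff_paramCover

theorem diffl_param (y : Param) :
    diffl (UnitCotangent.model.prod 𝓘(ℝ, ℝ)) (param ψ) y =
      (mfderiv (UnitCotangent.model.prod 𝓘(ℝ, ℝ)) (UnitCotangent.model.prod 𝓘(ℝ, ℝ))
        (MappingTorus.proj ψ) (paramCover y) :
        (Plane × EuclideanSpace ℝ (Fin 1)) × ℝ →L[ℝ] (Plane × EuclideanSpace ℝ (Fin 1)) × ℝ).comp
        (paramDiff y) :=
  ((MappingTorus.hasMFDerivAt_proj ψ (paramCover y)).comp y (hasMFDerivAt_paramCover y)).mfderiv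

theorem bijective_diffl_param (y : Param) :
    Function.Bijective (diffl (UnitCotangent.model.prod 𝓘(ℝ, ℝ)) (param ψ) y) := by
  have h1 : Function.Injective (paramDiff y) :=
    (Function.injective_id.prodMap (injective_circleDiff y.1.2)).prodMap Function.injective_id
  have h2 : Function.Bijective (paramDiff y) := by
    refine ⟨h1, ?_⟩
    exact (LinearMap.injective_iff_surjective_of_finrank_eq_finrank
      (f := (paramDiff y).toLinearMap) (by simp)).mp h1
  rw [diffl_param]
  exact (MappingTorus.bijective_mfderiv_proj ψ (paramCover y)).comp h2

theorem pull_alpha (y : Param) :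
    (MappingTorus.alpha ψ).pull (param ψ) y = ContinuousLinearMap.snd ℝ (Plane × ℝ) ℝ := by
  refine ContinuousLinearMap.ext fun v => ?_
  rw [OneForm.pull, diffl_param]
  exact MappingTorus.alpha_mfderiv_proj ψ (paramCover y) (paramDiff y v)

variable {ψ}

theorem pull_lam (hψ : Preserves liouville ψ) (y : Param) :
    (MappingTorus.lam ψ liouville).pull (param ψ) y = (innerSL ℝ (dir y.1.2)).comp
      ((ContinuousLinearMap.fst ℝ Plane ℝ).comp (ContinuousLinearMap.fst ℝ (Plane × ℝ) ℝ)) := by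
  refine ContinuousLinearMap.ext fun v => ?_
  rw [OneForm.pull, diffl_param]
  refine (MappingTorus.lam_mfderiv_proj ψ hψ (paramCover y) (paramDiff y v)).trans ?_
  rw [OneForm.val, liouville, mfderiv_fst]
  rfl

end Lift

/-- The model of the mapping torus of a diffeomorphism of the unit cotangent bundle. -/
abbrev MappingTorus.model := UnitCotangent.model.prod 𝓘(ℝ, ℝ)

/-- The model vector space of the mapping torus. -/
abbrev MappingTorus.Model : Type := (Plane × EuclideanSpace ℝ (Fin 1)) × ℝ

section Flat

variable {ψ : UnitCotangent ≃ₘ⟮UnitCotangent.model, UnitCotangent.model⟯ UnitCotangent}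

theorem isSmooth_alpha : (MappingTorus.alpha ψ).IsSmooth := by
  refine OneForm.isSmooth_of_pull _ (contMDiff_param ψ) (bijective_diffl_param ψ)
    (surjective_param ψ) ?_
  rw [funext (pull_alpha ψ)]
  exact contDiff_const

theorem isSmooth_lam (hψ : Preserves liouville ψ) : (MappingTorus.lam ψ liouville).IsSmooth := by
  refine OneForm.isSmooth_of_pull _ (contMDiff_param ψ) (bijective_diffl_param ψ)
    (surjective_param ψ) ?_
  rw [funext (pull_lam hψ), contDiff_clm_apply_iff]
  intro w
  exact (contDiff_dir.comp (contDiff_snd.comp contDiff_fst)).inner ℝ contDiff_const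

theorem d_alpha (m : MappingTorus ψ) : (MappingTorus.alpha ψ).d m = 0 := by
  obtain ⟨y, rfl⟩ := surjective_param ψ m
  have key : ∀ v w : MappingTorus.Model,
      (MappingTorus.alpha ψ).d (param ψ y) v w = 0 := by
    intro v w
    obtain ⟨v, rfl⟩ := (bijective_diffl_param ψ y).2 v
    obtain ⟨w, rfl⟩ := (bijective_diffl_param ψ y).2 w
    rw [OneForm.d_diffl _ isSmooth_alpha (contMDiff_param ψ), funext (pull_alpha ψ)]
    simp
  exact ContinuousLinearMap.ext fun v => ContinuousLinearMap.ext fun w => key v w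

theorem fderiv_pull_lam (hψ : Preserves liouville ψ) (y v w : Param) :
    fderiv ℝ ((MappingTorus.lam ψ liouville).pull (param ψ)) y v w =
      v.1.2 * inner ℝ (nrm y.1.2) w.1.1 := by
  rw [funext (pull_lam hψ)]
  set f : Param → Param →L[ℝ] ℝ := fun y => (innerSL ℝ (dir y.1.2)).comp
      ((ContinuousLinearMap.fst ℝ Plane ℝ).comp (ContinuousLinearMap.fst ℝ (Plane × ℝ) ℝ))
  have hf : DifferentiableAt ℝ f y := by
    have : ContDiff ℝ ∞ f := by
      rw [contDiff_clm_apply_iff]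
      intro w
      exact (contDiff_dir.comp (contDiff_snd.comp contDiff_fst)).inner ℝ contDiff_const
    exact this.differentiable (by simp) y
  have h1 := (hf.hasFDerivAt.clm_apply (hasFDerivAt_const w y)).fderiv
  have h0 : HasFDerivAt (fun y : Param => y.1.2)
      ((ContinuousLinearMap.snd ℝ Plane ℝ).comp (ContinuousLinearMap.fst ℝ (Plane × ℝ) ℝ)) y :=
    hasFDerivAt_snd.comp y hasFDerivAt_fst
  have h2 : HasFDerivAt (fun y : Param => dir y.1.2)
      (((1 : ℝ →L[ℝ] ℝ).smulRight (nrm y.1.2)).comp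
        ((ContinuousLinearMap.snd ℝ Plane ℝ).comp (ContinuousLinearMap.fst ℝ (Plane × ℝ) ℝ))) y :=
    HasFDerivAt.comp (g := dir) y (hasFDerivAt_dir y.1.2) h0
  have h3 : HasFDerivAt (fun y : Param => f y w) _ y := h2.inner ℝ (hasFDerivAt_const w.1.1 y)
  have h4 := congrArg (fun A : Param →L[ℝ] ℝ => A v) (h1.symm.trans h3.fderiv)
  simp at h4
  rw [h4, real_inner_smul_left]

theorem val_lam (hψ : Preserves liouville ψ) (y v : Param) :
    MappingTorus.lam ψ liouville (param ψ y) (diffl MappingTorus.model (param ψ) y v) =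
      inner ℝ (dir y.1.2) v.1.1 :=
  congrArg (fun A : Param →L[ℝ] ℝ => A v) (pull_lam hψ y)

theorem val_alpha (y v : Param) :
    MappingTorus.alpha ψ (param ψ y) (diffl MappingTorus.model (param ψ) y v) = v.2 :=
  congrArg (fun A : Param →L[ℝ] ℝ => A v) (pull_alpha ψ y)

variable (ψ) in
/-- The lcs form at a point, as a bilinear form on the model vector space. -/
def lcsVal (y : Param) : MappingTorus.Model →L[ℝ] MappingTorus.Model →L[ℝ] ℝ :=
  lcsForm (MappingTorus.lam ψ liouville) (MappingTorus.alpha ψ) (param ψ y)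

/-- The lcs form in the coordinates `(x, s, θ)`. -/
theorem lcsForm_param (hψ : Preserves liouville ψ) (y v w : Param) :
    lcsVal ψ y
        (diffl MappingTorus.model (param ψ) y v) (diffl MappingTorus.model (param ψ) y w) =
      v.1.2 * inner ℝ (nrm y.1.2) w.1.1 - w.1.2 * inner ℝ (nrm y.1.2) v.1.1 -
        (v.2 * inner ℝ (dir y.1.2) w.1.1 - inner ℝ (dir y.1.2) v.1.1 * w.2) := by
  have h1 := OneForm.d_diffl _ (isSmooth_lam hψ) (contMDiff_param ψ) y v w
  rw [fderiv_pull_lam hψ, fderiv_pull_lam hψ] at h1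
  rw [← h1, ← val_lam hψ, ← val_lam hψ, ← val_alpha (ψ := ψ), ← val_alpha (ψ := ψ)]
  rfl

/-- The lcs form is determined by its values in the coordinates `(x, s, θ)`. -/
theorem lcsForm_param_injective (hψ : Preserves liouville ψ) (y v v' : Param)
    (h : ∀ w, lcsVal ψ y
        (diffl MappingTorus.model (param ψ) y v) (diffl MappingTorus.model (param ψ) y w) =
      lcsVal ψ y
        (diffl MappingTorus.model (param ψ) y v') (diffl MappingTorus.model (param ψ) y w)) :
    v = v' := by
  simp only [lcsForm_param hψ] at h
  have h1 := h ((0, 0), 1)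
  have h2 := h ((dir y.1.2, 0), 0)
  have h3 := h ((0, 1), 0)
  have h4 := h ((nrm y.1.2, 0), 0)
  simp [inner_dir_dir, inner_nrm_nrm, inner_dir_nrm, inner_nrm_dir, -inner_self_eq_norm_sq_to_K]
    at h1 h2 h3 h4
  refine Prod.ext (Prod.ext ?_ h4) h2
  have h5 : inner ℝ (nrm y.1.2) (v.1.1 - v'.1.1) = (0 : ℝ) := by
    rw [inner_sub_right, h3, sub_self]
  have h6 := eq_smul_dir _ h5
  rw [inner_sub_right, h1, sub_self, zero_smul, sub_eq_zero] at h6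
  exact h6

theorem isExactLcs (hψ : Preserves liouville ψ) :
    IsExactLcs (MappingTorus.lam ψ liouville) (MappingTorus.alpha ψ) := by
  refine ⟨isSmooth_lam hψ, isSmooth_alpha, d_alpha, fun m v hv => ?_⟩
  obtain ⟨y, rfl⟩ := surjective_param ψ m
  obtain ⟨v', rfl⟩ := (bijective_diffl_param ψ y).2 v
  rw [lcsForm_param_injective hψ y v' 0 fun w => (hv _).trans (by simp)]
  exact map_zero _

variable (ψ) in
/-- The canonical distribution, as a subspace of the model vector space. -/
def distribution (y : Param) : Submodule ℝ MappingTorus.Model :=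
  canonicalDistribution (MappingTorus.lam ψ liouville) (MappingTorus.alpha ψ) (param ψ y)

/-- The canonical distribution is spanned by the geodesic vector field and `∂/∂θ`. -/
theorem distribution_eq (hψ : Preserves liouville ψ) (y : Param) :
    distribution ψ y = Submodule.span ℝ {diffl MappingTorus.model (param ψ) y ((0, 0), -1),
      diffl MappingTorus.model (param ψ) y ((dir y.1.2, 0), 0)} := by
  have hval (r : Param) (η : OneForm MappingTorus.model (MappingTorus ψ)) :
      lcsVal ψ y (diffl MappingTorus.model (param ψ) y r) = η.val (param ψ y) ↔
        ∀ w, lcsVal ψ y (diffl MappingTorus.model (param ψ) y r)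
          (diffl MappingTorus.model (param ψ) y w) = η.pull (param ψ) y w := by
    refine ⟨fun h w => by rw [h]; rfl, fun h => ContinuousLinearMap.ext fun w => ?_⟩
    obtain ⟨w, rfl⟩ := (bijective_diffl_param ψ y).2 w
    exact h w
  have h1 : lcsVal ψ y (diffl MappingTorus.model (param ψ) y ((0, 0), -1)) =
      (MappingTorus.lam ψ liouville).val (param ψ y) := by
    rw [hval]
    intro w
    rw [lcsForm_param hψ, pull_lam hψ]
    simp
  have h2 : lcsVal ψ y (diffl MappingTorus.model (param ψ) y ((dir y.1.2, 0), 0)) =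
      (MappingTorus.alpha ψ).val (param ψ y) := by
    rw [hval]
    intro w
    rw [lcsForm_param hψ, pull_alpha]
    simp [inner_dir_dir, inner_nrm_dir, -inner_self_eq_norm_sq_to_K]
  have key (X : MappingTorus.Model) (r : Param)
      (h : lcsVal ψ y X = lcsVal ψ y (diffl MappingTorus.model (param ψ) y r)) :
      X = diffl MappingTorus.model (param ψ) y r := by
    obtain ⟨v, rfl⟩ := (bijective_diffl_param ψ y).2 X
    rw [lcsForm_param_injective hψ y v r fun w => by rw [h]]
  have hset : {X : MappingTorus.Model | lcsVal ψ y X = (MappingTorus.lam ψ liouville).val (param ψ y) ∨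
      lcsVal ψ y X = (MappingTorus.alpha ψ).val (param ψ y)} =
      {diffl MappingTorus.model (param ψ) y ((0, 0), -1),
        diffl MappingTorus.model (param ψ) y ((dir y.1.2, 0), 0)} := by
    ext X
    simp only [mem_ofPred_eq, mem_insert_iff, mem_singleton_iff]
    constructor
    · rintro (h | h)
      · exact Or.inl (key X _ (h.trans h1.symm))
      · exact Or.inr (key X _ (h.trans h2.symm))
    · rintro (rfl | rfl)
      · exact Or.inl h1
      · exact Or.inr h2
  rw [← hset]
  rfl

theorem diffl_mem_distribution_iff (hψ : Preserves liouville ψ) (y v : Param) :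
    diffl MappingTorus.model (param ψ) y v ∈ distribution ψ y ↔
      ∃ a b : ℝ, v = ((a • dir y.1.2, 0), b) := by
  rw [distribution_eq hψ, Submodule.mem_span_pair]
  constructor
  · rintro ⟨a, b, h⟩
    rw [← map_smul, ← map_smul, ← map_add] at h
    refine ⟨b, -a, ?_⟩
    rw [← (bijective_diffl_param ψ y).1 h]
    simp
  · rintro ⟨a, b, rfl⟩
    refine ⟨-b, a, ?_⟩
    rw [← map_smul, ← map_smul, ← map_add]
    simp

theorem finrank_distribution (hψ : Preserves liouville ψ) (y : Param) :
    Module.finrank ℝ (distribution ψ y) = 2 := by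
  have hli : LinearIndependent ℝ ![diffl MappingTorus.model (param ψ) y ((0, 0), -1),
      diffl MappingTorus.model (param ψ) y ((dir y.1.2, 0), 0)] := by
    rw [LinearIndependent.pair_iff]
    intro a b h
    rw [← map_smul, ← map_smul, ← map_add] at h
    have := (bijective_diffl_param ψ y).1 (h.trans (map_zero _).symm)
    simpa [dir_ne_zero, and_comm] using this
  have := finrank_span_eq_card hli
  have hr (a b : MappingTorus.Model) : range ![a, b] = {a, b} := by
    ext x
    simp only [mem_range, Fin.exists_fin_two, Matrix.cons_val_zero, Matrix.cons_val_one,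
      mem_insert_iff, mem_singleton_iff, eq_comm (a := x)]
  rw [hr] at this
  rw [distribution_eq hψ, this]
  simp

end Flat

section Sard

open MeasureTheory Measure NNReal ENNReal

theorem norm_sub_le_pow {E G : Type*} [NormedAddCommGroup E] [NormedSpace ℝ E]
    [NormedAddCommGroup G] [NormedSpace ℝ G] {g : E → G} {K : Set E} (hK : Convex ℝ K)
    (hg : ∀ z ∈ K, DifferentiableAt ℝ g z) {x : E} (hx : x ∈ K) {C : ℝ} (hC : 0 ≤ C) {k : ℕ}
    (hb : ∀ z ∈ K, ‖fderiv ℝ g z‖ ≤ C * ‖z - x‖ ^ k) {y : E} (hy : y ∈ K) :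
    ‖g y - g x‖ ≤ C * ‖y - x‖ ^ (k + 1) := by
  have h := (hK.inter (convex_closedBall x ‖y - x‖)).norm_image_sub_le_of_norm_fderiv_le
    (𝕜 := ℝ) (f := g) (C := C * ‖y - x‖ ^ k) (fun z hz => hg z hz.1) (fun z hz => by
      refine (hb z hz.1).trans ?_
      have := hz.2
      rw [mem_closedBall, dist_eq_norm] at this
      gcongr) ⟨hx, by simp⟩ ⟨hy, by simp [dist_eq_norm]⟩
  rwa [mul_assoc, ← pow_succ] at h

theorem holderOnWith_of_norm_sub_le {f : ℂ → ℝ} {A : Set ℂ} {C : ℝ≥0} {k : ℕ}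
    (h : ∀ x ∈ A, ∀ y ∈ A, ‖f x - f y‖ ≤ C * ‖x - y‖ ^ k) :
    HolderOnWith C k f A := by
  intro x hx y hy
  rw [NNReal.coe_natCast, ENNReal.rpow_natCast, edist_nndist, edist_nndist, ← ENNReal.coe_pow,
    ← ENNReal.coe_mul, ENNReal.coe_le_coe, ← NNReal.coe_le_coe]
  simpa [dist_eq_norm] using h x hx y hy

/-- A function of two variables vanishing on a measurable set has vanishing derivative at almost
all points of the set. -/
theorem ae_fderiv_eq_zero (μ : Measure ℂ) [μ.IsAddHaarMeasure] {g : ℂ → ℂ →L[ℝ] ℝ} {A : Set ℂ}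
    (hA : MeasurableSet A) (h0 : ∀ z ∈ A, g z = 0) (hg : ∀ z ∈ A, DifferentiableAt ℝ g z) :
    ∀ᵐ z ∂μ.restrict A, fderiv ℝ g z = 0 := by
  let L : (ℂ →L[ℝ] ℝ) →L[ℝ] ℂ :=
    (ContinuousLinearMap.apply ℝ ℝ (1 : ℂ)).smulRight (1 : ℂ) +
      (ContinuousLinearMap.apply ℝ ℝ Complex.I).smulRight Complex.I
  have hL : ∀ a, L a = 0 → a = 0 := by
    intro a ha
    have h : (a 1 : ℂ) + a Complex.I * Complex.I = 0 := by simpa [L] using ha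
    have h1 := congrArg Complex.re h
    have h2 := congrArg Complex.im h
    simp at h1 h2
    refine ContinuousLinearMap.ext fun v => ?_
    have : v = v.re • (1 : ℂ) + v.im • Complex.I := by
      simp [Complex.re_add_im]
    rw [this, map_add, map_smul, map_smul, h1, h2]
    simp
  have happ : ApproximatesLinearOn (fun z => L (g z)) (0 : ℂ →L[ℝ] ℂ) A 0 := by
    intro x hx y hy
    simp [h0 x hx, h0 y hy]
  have := happ.norm_fderiv_sub_le μ hA (fun z => L.comp (fderiv ℝ g z)) fun z hz =>
    (L.hasFDerivAt.comp z (hg z hz).hasFDerivAt).hasFDerivWithinAt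
  filter_upwards [this] with z hz
  rw [sub_zero, nonpos_iff_eq_zero, nnnorm_eq_zero] at hz
  refine ContinuousLinearMap.ext fun v => hL _ ?_
  exact congrArg (fun B : ℂ →L[ℝ] ℂ => B v) hz

/-- **Sard's theorem** for smooth real functions of two real variables, locally. -/
theorem exists_nhds_volume_image_critical {f : ℂ → ℝ} {z₀ : ℂ} (hf : ContDiffAt ℝ ∞ f z₀) :
    ∃ V ∈ 𝓝 z₀, volume (f '' (V ∩ {z | fderiv ℝ f z = 0})) = 0 := by
  have hev : ∀ᶠ z in 𝓝 z₀, ContDiffAt ℝ 3 f z :=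
    (hf.of_le (m := 3) (WithTop.coe_le_coe.mpr le_top)).eventually (by simp)
  have h1 : ContDiffAt ℝ 2 (fderiv ℝ f) z₀ := hev.self_of_nhds.fderiv_right (by norm_num)
  have h2 : ContDiffAt ℝ 1 (fderiv ℝ (fderiv ℝ f)) z₀ := h1.fderiv_right (by norm_num)
  obtain ⟨C₂, t₂, ht₂, hC₂⟩ := (h1.of_le (by norm_num)).exists_lipschitzOnWith
  obtain ⟨C₃, t₃, ht₃, hC₃⟩ := h2.exists_lipschitzOnWith
  obtain ⟨r, hr, hK'⟩ := Metric.nhds_basis_closedBall.mem_iff.mp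
    (Filter.inter_mem hev (Filter.inter_mem ht₂ ht₃))
  set K := closedBall z₀ r
  have hball : ∀ z ∈ K, ContDiffAt ℝ 3 f z := fun z hz => (hK' hz).1
  replace hC₂ := hC₂.mono fun z hz => (hK' hz).2.1
  replace hC₃ := hC₃.mono fun z hz => (hK' hz).2.2
  have hK : Convex ℝ K := convex_closedBall z₀ r
  have hKc : IsCompact K := isCompact_closedBall z₀ r
  have hC₂0 : 0 ≤ (C₂ : ℝ) := C₂.coe_nonneg
  have hC₃0 : 0 ≤ (C₃ : ℝ) := C₃.coe_nonneg
  have d0 : ∀ z ∈ K, DifferentiableAt ℝ f z := fun z hz => (hball z hz).differentiableAt (by simp)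
  have d1 : ∀ z ∈ K, DifferentiableAt ℝ (fderiv ℝ f) z :=
    fun z hz => ((hball z hz).fderiv_right (m := 2) (by norm_num)).differentiableAt (by simp)
  set A := K ∩ {z | fderiv ℝ f z = 0} with hAdef
  have hAc : IsClosed A := by
    have : ContinuousOn (fderiv ℝ f) K := fun z hz => (d1 z hz).continuousAt.continuousWithinAt
    exact this.preimage_isClosed_of_isClosed hKc.isClosed isClosed_singleton
  have hquad : ∀ x ∈ A, ∀ y ∈ K, ‖f y - f x‖ ≤ C₂ * ‖y - x‖ ^ 2 := by
    rintro x ⟨hxK, hx⟩ y hy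
    refine norm_sub_le_pow hK d0 hxK hC₂0 (k := 1) (fun z hz => ?_) hy
    have := hC₂.norm_sub_le hz hxK
    rw [pow_one]
    rwa [show fderiv ℝ f x = 0 from hx, sub_zero] at this
  set A₂ := A ∩ {z | fderiv ℝ (fderiv ℝ f) z = 0} with hA₂
  have hcub : ∀ x ∈ A₂, ∀ y ∈ K, ‖f y - f x‖ ≤ C₃ * ‖y - x‖ ^ 3 := by
    rintro x ⟨⟨hxK, hx⟩, hx2⟩ y hy
    refine norm_sub_le_pow hK d0 hxK hC₃0 (k := 2) (fun z hz => ?_) hy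
    have := norm_sub_le_pow hK d1 hxK hC₃0 (k := 1) (fun w hw => by
      have := hC₃.norm_sub_le hw hxK
      rw [pow_one]
      rwa [show fderiv ℝ (fderiv ℝ f) x = 0 from hx2, sub_zero] at this) hz
    rwa [show fderiv ℝ f x = 0 from hx, sub_zero] at this
  refine ⟨K, closedBall_mem_nhds z₀ hr, ?_⟩
  change volume (f '' A) = 0
  rw [← hausdorffMeasure_real]
  have hfin : Module.finrank ℝ ℂ = 2 := Complex.finrank_real_complex
  have hH : (μH[(Module.finrank ℝ ℂ : ℝ)] : Measure ℂ).IsAddHaarMeasure := inferInstance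
  rw [hfin] at hH
  have hnull : (μH[((2 : ℕ) : ℝ)] : Measure ℂ) (A \ A₂) = 0 := by
    have := ae_fderiv_eq_zero (μH[((2 : ℕ) : ℝ)]) hAc.measurableSet (fun z hz => hz.2)
      (fun z hz => d1 z hz.1)
    rw [ae_restrict_iff' hAc.measurableSet] at this
    refine measure_mono_null ?_ this
    rintro z ⟨hz, hz2⟩ hcon
    exact hz2 ⟨hz, hcon hz⟩
  have e1 : μH[1] (f '' (A \ A₂)) = 0 := by
    have hh : HolderOnWith C₂ (2 : ℕ) f (A \ A₂) :=
      holderOnWith_of_norm_sub_le fun x hx y hy => by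
        simpa using hquad y hy.1 x hx.1.1
    have := hh.hausdorffMeasure_image_le (by norm_num) zero_le_one
    rw [mul_one, NNReal.coe_natCast, hnull, mul_zero] at this
    exact le_antisymm this zero_le
  have e2 : μH[1] (f '' A₂) = 0 := by
    have hh : HolderOnWith C₃ (3 : ℕ) f A₂ :=
      holderOnWith_of_norm_sub_le fun x hx y hy => by
        simpa using hcub y hy x hx.1.1
    have := hh.hausdorffMeasure_image_le (by norm_num) zero_le_one
    have h3 : (μH[((3 : ℝ≥0) : ℝ)] : Measure ℂ) A₂ = 0 := by
      apply hausdorffMeasure_of_dimH_lt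
      refine (dimH_mono (subset_univ _)).trans_lt ?_
      rw [Real.dimH_univ_eq_finrank, hfin]
      norm_num
    rw [mul_one, show (((3 : ℕ) : ℝ≥0) : ℝ) = ((3 : ℝ≥0) : ℝ) by norm_num, h3, mul_zero] at this
    exact le_antisymm this zero_le
  have : f '' A ⊆ f '' (A \ A₂) ∪ f '' A₂ := by
    rw [← image_union, sdiff_union_self]
    exact image_mono subset_union_left
  exact measure_mono_null this (measure_union_null e1 e2)

end Sard

/-- The geodesic flow on the unit cotangent bundle of the flat torus. -/
def geo (t : ℝ) (c : UnitCotangent) : UnitCotangent := (c.1 + Torus.proj (t • (c.2 : Plane)), c.2)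

theorem geo_zero (c : UnitCotangent) : geo 0 c = c := by
  refine Prod.ext ?_ rfl
  simp only [geo, zero_smul]
  exact add_zero c.1

theorem geo_geo (s t : ℝ) (c : UnitCotangent) : geo s (geo t c) = geo (s + t) c := by
  refine Prod.ext ?_ rfl
  simp only [geo, add_smul, Torus.proj_add]
  abel

theorem geo_injective (t : ℝ) : Function.Injective (geo t) :=
  Function.LeftInverse.injective (g := geo (-t)) fun c => by rw [geo_geo, neg_add_cancel, geo_zero]

section Dynamics

variable {φ : Torus ≃ₘ⟮𝓘(ℝ, Plane), 𝓘(ℝ, Plane)⟯ Torus} (hφ : IsFlatIsometry φ)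

theorem lift_geo (t : ℝ) (c : UnitCotangent) :
    unitCotangentLift φ hφ (geo t c) = geo t (unitCotangentLift φ hφ c) := by
  obtain ⟨A, hA, hadd⟩ := hφ.exists_affine
  refine Prod.ext ?_ (Subtype.ext ?_)
  · change φ (c.1 + Torus.proj (t • (c.2 : Plane))) =
      φ c.1 + Torus.proj (t • Torus.deriv φ c.1 c.2)
    rw [hadd, hA, map_smul]; rfl
  · change Torus.deriv φ (geo t c).1 c.2 = Torus.deriv φ c.1 c.2
    rw [hA, hA]

/-- The powers of the lift of `φ` to the unit cotangent bundle. -/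
def liftPow (n : ℤ) (c : UnitCotangent) : UnitCotangent :=
  ((unitCotangentLift φ hφ).toEquiv ^ n : Equiv.Perm UnitCotangent) c

theorem liftPow_zero (c : UnitCotangent) : liftPow hφ 0 c = c := rfl

theorem liftPow_add (m n : ℤ) (c : UnitCotangent) :
    liftPow hφ (m + n) c = liftPow hφ m (liftPow hφ n c) := by
  simp [liftPow, zpow_add]

theorem liftPow_geo (n : ℤ) (t : ℝ) (c : UnitCotangent) :
    liftPow hφ n (geo t c) = geo t (liftPow hφ n c) := by
  let g : Equiv.Perm UnitCotangent := ⟨geo t, geo (-t), fun c => by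
    rw [geo_geo, neg_add_cancel, geo_zero], fun c => by rw [geo_geo, add_neg_cancel, geo_zero]⟩
  have h : Commute (unitCotangentLift φ hφ).toEquiv g := Equiv.ext fun c => lift_geo hφ t c
  exact congrArg (fun e : Equiv.Perm UnitCotangent => e c) (h.zpow_left n)

theorem fst_liftPow_natCast (k : ℕ) (c : UnitCotangent) : (liftPow hφ k c).1 = φ^[k] c.1 := by
  induction k with
  | zero => rfl
  | succ k ih =>
    rw [Function.iterate_succ_apply', ← ih, Nat.cast_succ, add_comm, liftPow_add]
    rfl

theorem proj_eq_proj_iff (c c' : UnitCotangent) (θ θ' : ℝ) :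
    MappingTorus.proj (unitCotangentLift φ hφ) (c, θ) =
      MappingTorus.proj (unitCotangentLift φ hφ) (c', θ') ↔
      ∃ n : ℤ, liftPow hφ n c = c' ∧ θ + n = θ' := by
  rw [MappingTorus.proj_eq_iff]
  simp [deck, liftPow]

/-- The pairs `(t, n)` such that the `n`-th power of the lift of `φ` moves `c` by the time `t`
along its geodesic. -/
def returnGroup (c : UnitCotangent) : AddSubgroup (ℝ × ℤ) where
  carrier := {a | liftPow hφ a.2 c = geo a.1 c}
  zero_mem' := (geo_zero c).symm
  add_mem' := by
    rintro ⟨s, m⟩ ⟨t, n⟩ (h1 : liftPow hφ m c = geo s c) (h2 : liftPow hφ n c = geo t c)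
    change liftPow hφ (m + n) c = geo (s + t) c
    rw [liftPow_add, h2, liftPow_geo, h1, geo_geo, add_comm]
  neg_mem' := by
    rintro ⟨t, n⟩ (h : liftPow hφ n c = geo t c)
    change liftPow hφ (-n) c = geo (-t) c
    apply geo_injective t
    rw [← liftPow_geo, ← h, ← liftPow_add, neg_add_cancel, liftPow_zero, geo_geo, add_neg_cancel,
      geo_zero]

theorem mem_returnGroup {c : UnitCotangent} {t : ℝ} {n : ℤ} :
    (t, n) ∈ returnGroup hφ c ↔ liftPow hφ n c = geo t c := Iff.rfl

/-- Some nontrivial power of the lift of `φ` maps `c` to a point of its geodesic. -/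
def Returns (c : UnitCotangent) : Prop := ∃ n : ℤ, n ≠ 0 ∧ ∃ t : ℝ, liftPow hφ n c = geo t c

variable {hφ}

/-- If no iterate of `φ` preserves a closed geodesic, a geodesic that returns to itself is not
closed. -/
theorem eq_zero_of_geo_eq (hfix : FixesNoClosedGeodesic φ) {c : UnitCotangent}
    (hc : Returns hφ c) {t : ℝ} (ht : geo t c = c) : t = 0 := by
  by_contra hne
  obtain ⟨k, hk, s, hs⟩ : ∃ k : ℕ, 0 < k ∧ ∃ s : ℝ, liftPow hφ k c = geo s c := by
    obtain ⟨n, hn, s, hs⟩ := hc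
    rcases lt_or_gt_of_ne hn with h | h
    · refine ⟨(-n).toNat, by omega, -s, ?_⟩
      rw [Int.toNat_of_nonneg (by omega)]
      exact (returnGroup hφ c).neg_mem (x := (s, n)) hs
    · exact ⟨n.toNat, by omega, s, by rwa [Int.toNat_of_nonneg h.le]⟩
  have hγ (r : ℝ) : φ^[k] (geo r c).1 = (geo (r + s) c).1 := by
    rw [← fst_liftPow_natCast hφ, liftPow_geo, hs, geo_geo]
  refine hfix k hk (fun r => (geo (r * t) c).1) ⟨?_, fun r => ?_⟩ ?_
  · obtain ⟨x, hx⟩ := Torus.surjective_proj c.1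
    refine ⟨x, t • (c.2 : Plane), smul_ne_zero hne ?_, fun r => ?_⟩
    · have := mem_sphere_zero_iff_norm.mp c.2.2
      rw [← norm_ne_zero_iff, this]; exact one_ne_zero
    · rw [Torus.proj_add, hx, smul_smul]; rfl
  · change (geo ((r + 1) * t) c).1 = (geo (r * t) c).1
    rw [add_mul, one_mul, ← geo_geo, ht]
  · apply Subset.antisymm
    · rintro _ ⟨_, ⟨r, rfl⟩, rfl⟩
      refine ⟨r + s / t, ?_⟩
      simp only [hγ]
      rw [add_mul, div_mul_cancel₀ _ hne]
    · rintro _ ⟨r, rfl⟩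
      refine ⟨_, ⟨r - s / t, rfl⟩, ?_⟩
      simp only [hγ]
      rw [sub_mul, div_mul_cancel₀ _ hne, sub_add_cancel]

theorem exists_slope (hfix : FixesNoClosedGeodesic φ) {c : UnitCotangent} (hc : Returns hφ c) :
    ∃ κ : ℝ, ∀ (n : ℤ) (t : ℝ), liftPow hφ n c = geo t c → t = κ * n := by
  obtain ⟨n₀, hn₀, t₀, h₀⟩ := hc
  refine ⟨t₀ / n₀, fun n t h => ?_⟩
  have h1 := (returnGroup hφ c).sub_mem
    ((returnGroup hφ c).zsmul_mem (x := (t₀, n₀)) h₀ n)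
    ((returnGroup hφ c).zsmul_mem (x := (t, n)) h n₀)
  have h2 : n • (t₀, n₀) - n₀ • (t, n) = (n * t₀ - n₀ * t, (0 : ℤ)) := by
    refine Prod.ext (by simp) ?_
    simp; ring
  rw [h2, mem_returnGroup, liftPow_zero] at h1
  have h3 := eq_zero_of_geo_eq hfix ⟨n₀, hn₀, t₀, h₀⟩ h1.symm
  have : (n₀ : ℝ) ≠ 0 := by exact_mod_cast hn₀
  field_simp
  linarith

variable (hφ)

/-- The leaf through the points over `c` of the foliation tangent to the canonical
distribution. -/
def leaf (c : UnitCotangent) : Set (MappingTorus (unitCotangentLift φ hφ)) :=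
  {m | ∃ t θ, m = MappingTorus.proj (unitCotangentLift φ hφ) (geo t c, θ)}

theorem exists_mem_leaf (m : MappingTorus (unitCotangentLift φ hφ)) : ∃ c, m ∈ leaf hφ c := by
  obtain ⟨⟨c, θ⟩, rfl⟩ := MappingTorus.surjective_proj _ m
  exact ⟨c, 0, θ, by rw [geo_zero]⟩

variable {hφ}

theorem leaf_subset_of_mem {c c' : UnitCotangent} {m : MappingTorus (unitCotangentLift φ hφ)}
    (h : m ∈ leaf hφ c) (h' : m ∈ leaf hφ c') : leaf hφ c' ⊆ leaf hφ c := by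
  obtain ⟨t, θ, rfl⟩ := h
  obtain ⟨t', θ', h'⟩ := h'
  obtain ⟨n, hn, -⟩ := (proj_eq_proj_iff hφ _ _ _ _).mp h'
  rintro _ ⟨s, τ, rfl⟩
  refine ⟨s - t' + t, τ - n, ?_⟩
  rw [eq_comm, proj_eq_proj_iff]
  refine ⟨n, ?_, by ring⟩
  rw [← geo_geo (s - t') t, liftPow_geo, hn, geo_geo, sub_add_cancel]

variable (hφ)

instance : Nonempty UnitCotangent := ⟨(0, circlePt 0)⟩

/-- A choice of a point `c` for each leaf. -/
def leafBase (m : MappingTorus (unitCotangentLift φ hφ)) : UnitCotangent :=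
  Classical.epsilon fun c => m ∈ leaf hφ c

theorem mem_leaf_leafBase (m : MappingTorus (unitCotangentLift φ hφ)) :
    m ∈ leaf hφ (leafBase hφ m) :=
  Classical.epsilon_spec (exists_mem_leaf hφ m)

variable {hφ}

theorem leafBase_eq {c : UnitCotangent} {m m' : MappingTorus (unitCotangentLift φ hφ)}
    (h : m ∈ leaf hφ c) (h' : m' ∈ leaf hφ c) : leafBase hφ m = leafBase hφ m' := by
  refine congrArg Classical.epsilon (funext fun c' => propext ⟨fun hc => ?_, fun hc => ?_⟩)
  · exact leaf_subset_of_mem hc h h'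
  · exact leaf_subset_of_mem hc h' h

variable (hφ)

open Classical in
/-- A primitive of the Lee form on the leaves that do not return, and zero on the others. -/
def leafPrimitive (m : MappingTorus (unitCotangentLift φ hφ)) : ℝ :=
  if Returns hφ (leafBase hφ m) then 0 else
    Classical.epsilon fun θ => ∃ t, m = MappingTorus.proj (unitCotangentLift φ hφ)
      (geo t (leafBase hφ m), θ)

variable {hφ}

theorem leafPrimitive_of_returns {m : MappingTorus (unitCotangentLift φ hφ)}
    (h : Returns hφ (leafBase hφ m)) : leafPrimitive hφ m = 0 := if_pos h

theorem leafPrimitive_of_not_returns {m : MappingTorus (unitCotangentLift φ hφ)}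
    (h : ¬ Returns hφ (leafBase hφ m)) {t θ : ℝ}
    (hm : m = MappingTorus.proj (unitCotangentLift φ hφ) (geo t (leafBase hφ m), θ)) :
    leafPrimitive hφ m = θ := by
  rw [leafPrimitive, if_neg h]
  obtain ⟨t', ht'⟩ := Classical.epsilon_spec (p := fun θ => ∃ t, m = MappingTorus.proj
    (unitCotangentLift φ hφ) (geo t (leafBase hφ m), θ)) ⟨θ, t, hm⟩
  obtain ⟨n, hn, hθ⟩ := (proj_eq_proj_iff hφ _ _ _ _).mp (ht'.symm.trans hm)
  have hn0 : n = 0 := by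
    by_contra hne
    refine h ⟨n, hne, t - t', geo_injective t' ?_⟩
    rw [← liftPow_geo, hn, geo_geo, add_sub_cancel]
  simpa [hn0] using hθ

end Dynamics

section LocalForm

variable {E : Type*} [NormedAddCommGroup E] [NormedSpace ℝ E]
  {H : Type*} [TopologicalSpace H] (I : ModelWithCorners ℝ E H)
  {M : Type*} [TopologicalSpace M] [ChartedSpace H M]
  {X : Type*} [TopologicalSpace X] [ChartedSpace ℂ X]

/-- The differential of a map from a surface, in the trivializations of the tangent spaces by the
preferred charts. -/
def surfDiff (v : X → M) (z : X) : ℂ →L[ℝ] E := mfderiv 𝓘(ℝ, ℂ) I v z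

theorem hasMFDerivAt_surfDiff {v : X → M} {z : X}
    (h : MDifferentiableAt 𝓘(ℝ, ℂ) I v z) : HasMFDerivAt 𝓘(ℝ, ℂ) I v z (surfDiff (E := E) I v z) :=
  h.hasMFDerivAt

/-- A function that is smooth near a point and has zero differential there is locally constant. -/
theorem eventually_eq_of_surfDiff_eq_zero {G : Type*} [NormedAddCommGroup G] [NormedSpace ℝ G]
    [IsManifold 𝓘(ℝ, ℂ) ∞ X] {f : X → G} {z₀ : X}
    (hf : ∀ᶠ z in 𝓝 z₀, MDifferentiableAt 𝓘(ℝ, ℂ) 𝓘(ℝ, G) f z ∧ surfDiff 𝓘(ℝ, G) f z = 0) :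
    ∀ᶠ z in 𝓝 z₀, f z = f z₀ := by
  set χ := extChartAt 𝓘(ℝ, ℂ) z₀
  have hχ : ∀ᶠ e in 𝓝 (χ z₀), e ∈ χ.target := extChartAt_target_mem_nhds z₀
  have hsymm : Filter.Tendsto χ.symm (𝓝 (χ z₀)) (𝓝 z₀) := by
    have := continuousAt_extChartAt_symm (I := 𝓘(ℝ, ℂ)) z₀
    rwa [ContinuousAt, extChartAt_to_inv] at this
  have hd : ∀ᶠ e in 𝓝 (χ z₀), HasFDerivAt (f ∘ χ.symm) (0 : ℂ →L[ℝ] G) e := by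
    filter_upwards [hχ, hsymm.eventually hf] with e he hfe
    have h1 := (hasMFDerivAt_surfDiff _ hfe.1).comp e
      (mdifferentiableAt_extChartAt_symm' he).hasMFDerivAt
    have h2 : surfDiff 𝓘(ℝ, G) f (χ.symm e) = 0 := hfe.2
    rw [h2] at h1
    have h3 : HasMFDerivAt 𝓘(ℝ, ℂ) 𝓘(ℝ, G) (f ∘ χ.symm) e (0 : ℂ →L[ℝ] G) := by
      exact h1.congr_mfderiv (ContinuousLinearMap.zero_comp _)
    exact h3.hasFDerivAt
  obtain ⟨r, hr, hball⟩ := Metric.eventually_nhds_iff_ball.mp hd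
  have hconst : ∀ e ∈ ball (χ z₀) r, f (χ.symm e) = f (χ.symm (χ z₀)) := by
    intro e he
    exact (convex_ball (χ z₀) r).is_const_of_fderivWithin_eq_zero (𝕜 := ℝ) (f := f ∘ χ.symm)
      (fun w hw => (hball w hw).differentiableAt.differentiableWithinAt)
      (fun w hw => by
        rw [fderivWithin_of_isOpen isOpen_ball hw]; exact (hball w hw).fderiv)
      he (mem_ball_self hr)
  filter_upwards [(continuousAt_extChartAt (I := 𝓘(ℝ, ℂ)) z₀).eventually (ball_mem_nhds _ hr),
    extChartAt_source_mem_nhds (I := 𝓘(ℝ, ℂ)) z₀] with z hz hz'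
  have := hconst _ hz
  rwa [χ.left_inv hz', extChartAt_to_inv] at this

variable {φ : Torus ≃ₘ⟮𝓘(ℝ, Plane), 𝓘(ℝ, Plane)⟯ Torus} {hφ : IsFlatIsometry φ}

variable (hφ) in
/-- The canonical distribution of the mapping torus of the lift of `φ`, as a family of subspaces of
the model vector space. -/
def distAt (m : MappingTorus (unitCotangentLift φ hφ)) : Submodule ℝ MappingTorus.Model :=
  canonicalDistribution (MappingTorus.lam (unitCotangentLift φ hφ) liouville)
    (MappingTorus.alpha (unitCotangentLift φ hφ)) m

/-- The map `v` from a surface is tangent to the canonical distribution where its differential is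
nonzero. -/
def IsTangent (v : X → MappingTorus (unitCotangentLift φ hφ)) : Prop :=
  ∀ z, surfDiff MappingTorus.model v z ≠ 0 →
    LinearMap.range (surfDiff MappingTorus.model v z).toLinearMap = distAt hφ (v z)

/-- Near a point, a map tangent to the canonical distribution is described by two functions, the
time along the geodesic and the coordinate `θ`. -/
theorem exists_leaf_coordinates [IsManifold 𝓘(ℝ, ℂ) ∞ X]
    {v : X → MappingTorus (unitCotangentLift φ hφ)}
    (hv : ContMDiff 𝓘(ℝ, ℂ) MappingTorus.model ∞ v) (htan : IsTangent v) {z₀ : X}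
    {c : UnitCotangent} {t₀ θ₀ : ℝ}
    (hz₀ : v z₀ = MappingTorus.proj (unitCotangentLift φ hφ) (geo t₀ c, θ₀)) :
    ∃ f : X → ℝ × ℝ, f z₀ = (t₀, θ₀) ∧ ∀ᶠ z in 𝓝 z₀,
      ContMDiffAt 𝓘(ℝ, ℂ) 𝓘(ℝ, ℝ × ℝ) ∞ f z ∧
      v z = MappingTorus.proj (unitCotangentLift φ hφ) (geo (f z).1 c, (f z).2) ∧
      (surfDiff MappingTorus.model v z = 0 → surfDiff 𝓘(ℝ, ℝ × ℝ) f z = 0) ∧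
      (surfDiff MappingTorus.model v z ≠ 0 →
        Function.Surjective (surfDiff 𝓘(ℝ, ℝ × ℝ) f z)) ∧
      ∀ w, (MappingTorus.alpha (unitCotangentLift φ hφ)).val (v z)
        (surfDiff MappingTorus.model v z w) = (surfDiff 𝓘(ℝ, ℝ × ℝ) f z w).2 := by
  have hpres : Preserves liouville (unitCotangentLift φ hφ) := preserves_liouville hφ
  obtain ⟨x₀, hx₀⟩ := Torus.surjective_proj (geo t₀ c).1
  obtain ⟨s₀, hs₀⟩ := surjective_circlePt (geo t₀ c).2
  set y₀ : Param := ((x₀, s₀), θ₀) with hy₀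
  have hparam : ∀ a b : ℝ, param (unitCotangentLift φ hφ) ((x₀ + a • dir s₀, s₀), b) =
      MappingTorus.proj (unitCotangentLift φ hφ) (geo (t₀ + a) c, b) := by
    intro a b
    have : paramCover ((x₀ + a • dir s₀, s₀), b) = (geo a (geo t₀ c), b) := by
      refine Prod.ext (Prod.ext ?_ hs₀) rfl
      change Torus.proj (x₀ + a • dir s₀) = (geo t₀ c).1 + Torus.proj (a • ((geo t₀ c).2 : Plane))
      rw [← hs₀, Torus.proj_add, hx₀]
      rfl
    rw [param, this, geo_geo, add_comm]
  have hy₀z : param (unitCotangentLift φ hφ) y₀ = v z₀ := by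
    have := hparam 0 θ₀
    rw [zero_smul, add_zero, add_zero] at this
    rw [hz₀, ← this]
  obtain ⟨k, hk₀, hk⟩ := exists_local_section (contMDiff_param (unitCotangentLift φ hφ)) (bijective_diffl_param (unitCotangentLift φ hφ)) y₀
  rw [hy₀z] at hk₀ hk
  set û : X → Param := k ∘ v with hû
  have hlift : ∀ᶠ z in 𝓝 z₀, ContMDiffAt 𝓘(ℝ, ℂ) 𝓘(ℝ, Param) ∞ û z ∧ param (unitCotangentLift φ hφ) (û z) = v z := by
    filter_upwards [hv.continuous.continuousAt.eventually hk] with z hz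
    exact ⟨hz.1.comp z (hv z), hz.2⟩
  have hchain : ∀ᶠ z in 𝓝 z₀, surfDiff MappingTorus.model v z =
      (diffl MappingTorus.model (param (unitCotangentLift φ hφ)) (û z)).comp (surfDiff 𝓘(ℝ, Param) û z) := by
    filter_upwards [hlift.eventually_nhds] with z hz
    have h1 : HasMFDerivAt 𝓘(ℝ, Param) MappingTorus.model (param (unitCotangentLift φ hφ)) (û z)
        (diffl MappingTorus.model (param (unitCotangentLift φ hφ)) (û z)) :=
      ((contMDiff_param (unitCotangentLift φ hφ)).mdifferentiable (by simp) (û z)).hasMFDerivAt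
    have h2 := h1.comp z
      (hasMFDerivAt_surfDiff _ (hz.self_of_nhds.1.mdifferentiableAt (by simp)))
    exact (h2.congr_of_eventuallyEq (f₁ := v) (hz.mono fun w hw => hw.2.symm)).mfderiv
  have hform : ∀ᶠ z in 𝓝 z₀, ∀ w, ∃ a b : ℝ,
      surfDiff 𝓘(ℝ, Param) û z w = ((a • dir (û z).1.2, 0), b) := by
    filter_upwards [hlift, hchain] with z hz hc w
    rw [← diffl_mem_distribution_iff hpres (û z)]
    have h1 : diffl MappingTorus.model (param (unitCotangentLift φ hφ)) (û z) (surfDiff 𝓘(ℝ, Param) û z w) =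
        surfDiff MappingTorus.model v z w := by rw [hc]; rfl
    rw [h1]
    by_cases h0 : surfDiff MappingTorus.model v z = 0
    · rw [h0]; exact zero_mem _
    · change _ ∈ distAt hφ (param (unitCotangentLift φ hφ) (û z))
      rw [hz.2, ← htan z h0]
      exact ⟨w, rfl⟩
  have hcomp : ∀ {G : Type} [NormedAddCommGroup G] [NormedSpace ℝ G] (L : Param →L[ℝ] G),
      ∀ᶠ z in 𝓝 z₀, MDifferentiableAt 𝓘(ℝ, ℂ) 𝓘(ℝ, G) (fun z => L (û z)) z ∧
        surfDiff 𝓘(ℝ, G) (fun z => L (û z)) z = L.comp (surfDiff 𝓘(ℝ, Param) û z) := by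
    intro G _ _ L
    filter_upwards [hlift] with z hz
    have h1 : HasMFDerivAt 𝓘(ℝ, Param) 𝓘(ℝ, G) L (û z) L := L.hasFDerivAt.hasMFDerivAt
    have h2 := h1.comp z (hasMFDerivAt_surfDiff _ (hz.1.mdifferentiableAt (by simp)))
    exact ⟨h2.mdifferentiableAt, h2.mfderiv⟩
  have hs : ∀ᶠ z in 𝓝 z₀, (û z).1.2 = s₀ := by
    let L : Param →L[ℝ] ℝ :=
      (ContinuousLinearMap.snd ℝ Plane ℝ).comp (ContinuousLinearMap.fst ℝ (Plane × ℝ) ℝ)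
    have := eventually_eq_of_surfDiff_eq_zero (f := fun z => L (û z)) (z₀ := z₀) (by
      filter_upwards [hcomp L, hform] with z hz hf
      refine ⟨hz.1, ?_⟩
      rw [hz.2]
      refine ContinuousLinearMap.ext fun w => ?_
      obtain ⟨a, b, hab⟩ := hf w
      rw [ContinuousLinearMap.comp_apply, hab]
      rfl)
    filter_upwards [this] with z hz
    have h1 : (û z).1.2 = (û z₀).1.2 := hz
    rw [h1, hû, Function.comp_apply, hk₀]
  have hx : ∀ᶠ z in 𝓝 z₀, inner ℝ (nrm s₀) ((û z).1.1 - x₀) = (0 : ℝ) := by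
    let L : Param →L[ℝ] ℝ := (innerSL ℝ (nrm s₀)).comp
      ((ContinuousLinearMap.fst ℝ Plane ℝ).comp (ContinuousLinearMap.fst ℝ (Plane × ℝ) ℝ))
    have := eventually_eq_of_surfDiff_eq_zero (f := fun z => L (û z)) (z₀ := z₀) (by
      filter_upwards [hcomp L, hform, hs] with z hz hf hsz
      refine ⟨hz.1, ?_⟩
      rw [hz.2]
      refine ContinuousLinearMap.ext fun w => ?_
      obtain ⟨a, b, hab⟩ := hf w
      rw [ContinuousLinearMap.comp_apply, hab, hsz]
      change inner ℝ (nrm s₀) (a • dir s₀) = (0 : ℝ)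
      rw [inner_smul_right, inner_nrm_dir, mul_zero])
    filter_upwards [this] with z hz
    have h1 : inner ℝ (nrm s₀) (û z).1.1 = (inner ℝ (nrm s₀) (û z₀).1.1 : ℝ) := hz
    rw [inner_sub_right, h1, hû, Function.comp_apply, hk₀, sub_self]
  let L : Param →L[ℝ] ℝ × ℝ := ((innerSL ℝ (dir s₀)).comp
    ((ContinuousLinearMap.fst ℝ Plane ℝ).comp (ContinuousLinearMap.fst ℝ (Plane × ℝ) ℝ))).prod
      (ContinuousLinearMap.snd ℝ (Plane × ℝ) ℝ)
  have hL : ∀ a b : ℝ, L ((a • dir s₀, 0), b) = (a, b) := by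
    intro a b
    refine Prod.ext ?_ rfl
    change inner ℝ (dir s₀) (a • dir s₀) = a
    rw [inner_smul_right, inner_dir_dir, mul_one]
  let d : ℝ × ℝ := (t₀ - inner ℝ (dir s₀) x₀, 0)
  have hfd : ∀ᶠ z in 𝓝 z₀, surfDiff 𝓘(ℝ, ℝ × ℝ) (fun z => L (û z) + d) z =
      L.comp (surfDiff 𝓘(ℝ, Param) û z) := by
    filter_upwards [hlift] with z hz
    have h1 : HasMFDerivAt 𝓘(ℝ, Param) 𝓘(ℝ, ℝ × ℝ) (fun y => L y + d) (û z) L :=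
      (L.hasFDerivAt.add_const d).hasMFDerivAt
    exact (h1.comp z (hasMFDerivAt_surfDiff _ (hz.1.mdifferentiableAt (by simp)))).mfderiv
  refine ⟨fun z => L (û z) + d, ?_, ?_⟩
  · have : û z₀ = y₀ := hk₀
    change L (û z₀) + d = _
    rw [this]
    refine Prod.ext ?_ (add_zero _)
    change inner ℝ (dir s₀) x₀ + (t₀ - inner ℝ (dir s₀) x₀) = t₀
    ring
  filter_upwards [hlift, hchain, hform, hs, hx, hfd] with z hz hc hf hsz hxz hd
  have hinj : Function.Injective (diffl MappingTorus.model (param (unitCotangentLift φ hφ)) (û z)) :=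
    (bijective_diffl_param (unitCotangentLift φ hφ) (û z)).1
  refine ⟨?_, ?_, fun h0 => ?_, fun h0 => ?_, fun w => ?_⟩
  · have h1 : ContMDiff 𝓘(ℝ, Param) 𝓘(ℝ, ℝ × ℝ) ∞ (fun y => L y + d) :=
      (L.contDiff.add contDiff_const).contMDiff
    exact (h1 (û z)).comp z hz.1
  · have h1 := eq_smul_dir s₀ hxz
    have h2 : û z = ((x₀ + (inner ℝ (dir s₀) ((û z).1.1 - x₀) : ℝ) • dir s₀, s₀), (û z).2) := by
      refine Prod.ext (Prod.ext ?_ hsz) rfl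
      rw [← h1]; simp
    have h3 := hparam (inner ℝ (dir s₀) ((û z).1.1 - x₀)) (û z).2
    rw [← h2, hz.2] at h3
    have h4 : L (û z) + d = (t₀ + inner ℝ (dir s₀) ((û z).1.1 - x₀), (û z).2) := by
      refine Prod.ext ?_ (add_zero _)
      change inner ℝ (dir s₀) (û z).1.1 + (t₀ - inner ℝ (dir s₀) x₀) =
        t₀ + inner ℝ (dir s₀) ((û z).1.1 - x₀)
      rw [inner_sub_right]; ring
    rw [h4, h3]
  · rw [hd]
    refine ContinuousLinearMap.ext fun w => ?_
    have h1 : diffl MappingTorus.model (param (unitCotangentLift φ hφ)) (û z) (surfDiff 𝓘(ℝ, Param) û z w) = 0 := by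
      rw [hc] at h0
      exact congrArg (fun A : ℂ →L[ℝ] MappingTorus.Model => A w) h0
    have h2 : surfDiff 𝓘(ℝ, Param) û z w = 0 := hinj (h1.trans (map_zero _).symm)
    rw [ContinuousLinearMap.comp_apply, h2, map_zero]
    rfl
  · rintro ⟨a, b⟩
    have h1 : diffl MappingTorus.model (param (unitCotangentLift φ hφ)) (û z) ((a • dir (û z).1.2, 0), b) ∈
        distAt hφ (v z) := by
      rw [← hz.2]
      exact (diffl_mem_distribution_iff hpres (û z) _).mpr ⟨a, b, rfl⟩
    rw [← htan z h0] at h1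
    obtain ⟨w, hw⟩ := h1
    refine ⟨w, ?_⟩
    have h2 : surfDiff 𝓘(ℝ, Param) û z w = ((a • dir (û z).1.2, 0), b) := by
      apply hinj
      rw [← hw, hc]
      rfl
    rw [hd, ContinuousLinearMap.comp_apply, h2, hsz, hL]
  · rw [hd, hc, ← hz.2]
    exact val_alpha (û z) (surfDiff 𝓘(ℝ, Param) û z w)

end LocalForm

section Surface

variable {X : Type*} [TopologicalSpace X] [ChartedSpace ℂ X]

theorem tendsto_extChartAt_symm_surface (z : X) :
    Filter.Tendsto (extChartAt 𝓘(ℝ, ℂ) z).symm (𝓝 (extChartAt 𝓘(ℝ, ℂ) z z)) (𝓝 z) := by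
  have := continuousAt_extChartAt_symm (I := 𝓘(ℝ, ℂ)) z
  rwa [ContinuousAt, extChartAt_to_inv] at this

theorem hasFDerivAt_chart {G : Type*} [NormedAddCommGroup G] [NormedSpace ℝ G] {f : X → G} {z : X}
    (hf : MDifferentiableAt 𝓘(ℝ, ℂ) 𝓘(ℝ, G) f z) :
    HasFDerivAt (f ∘ (extChartAt 𝓘(ℝ, ℂ) z).symm) (surfDiff 𝓘(ℝ, G) f z)
      (extChartAt 𝓘(ℝ, ℂ) z z) := by
  have h : HasFDerivWithinAt (f ∘ (extChartAt 𝓘(ℝ, ℂ) z).symm) (surfDiff 𝓘(ℝ, G) f z)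
      (range (id : ℂ → ℂ)) (extChartAt 𝓘(ℝ, ℂ) z z) := hf.hasMFDerivAt.2
  rwa [range_id, hasFDerivWithinAt_univ] at h

variable [IsManifold 𝓘(ℝ, ℂ) ∞ X]

theorem contDiffAt_chart {G : Type*} [NormedAddCommGroup G] [NormedSpace ℝ G] {f : X → G} {z : X}
    (hf : ContMDiffAt 𝓘(ℝ, ℂ) 𝓘(ℝ, G) ∞ f z) :
    ContDiffAt ℝ ∞ (f ∘ (extChartAt 𝓘(ℝ, ℂ) z).symm) (extChartAt 𝓘(ℝ, ℂ) z z) := by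
  have h1 := contMDiffWithinAt_extChartAt_symm_range (I := 𝓘(ℝ, ℂ)) (n := ∞) z
    (mem_extChartAt_target z)
  rw [ModelWithCorners.range_eq_univ, contMDiffWithinAt_univ] at h1
  have h2 : ContMDiffAt 𝓘(ℝ, ℂ) 𝓘(ℝ, G) ∞ f
      ((extChartAt 𝓘(ℝ, ℂ) z).symm (extChartAt 𝓘(ℝ, ℂ) z z)) := by
    rwa [extChartAt_to_inv]
  exact (h2.comp _ h1).contDiffAt

/-- A smooth map with surjective differential at a point is open there. -/
theorem nhds_le_map_of_surjective {G : Type*} [NormedAddCommGroup G] [NormedSpace ℝ G]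
    [CompleteSpace G] {f : X → G} {z : X} (hf : ContMDiffAt 𝓘(ℝ, ℂ) 𝓘(ℝ, G) ∞ f z)
    (hs : Function.Surjective (surfDiff 𝓘(ℝ, G) f z)) : 𝓝 (f z) ≤ Filter.map f (𝓝 z) := by
  have h1 := (contDiffAt_chart hf).hasStrictFDerivAt'
    (hasFDerivAt_chart (hf.mdifferentiableAt (by simp))) (by simp)
  have h2 := h1.map_nhds_eq_of_surj (LinearMap.range_eq_top.mpr hs)
  rw [Function.comp_apply, extChartAt_to_inv] at h2
  rw [← h2, ← Filter.map_map]
  exact Filter.map_mono (tendsto_extChartAt_symm_surface z)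

open MeasureTheory in
/-- Sard's theorem near a point of a surface. -/
theorem exists_nhds_volume_image_snd {f : X → ℝ × ℝ} {z₀ : X}
    (hf : ∀ᶠ z in 𝓝 z₀, ContMDiffAt 𝓘(ℝ, ℂ) 𝓘(ℝ, ℝ × ℝ) ∞ f z) :
    ∃ V ∈ 𝓝 z₀, volume ((fun z => (f z).2) '' (V ∩ {z | surfDiff 𝓘(ℝ, ℝ × ℝ) f z = 0})) = 0 := by
  set χ := extChartAt 𝓘(ℝ, ℂ) z₀
  obtain ⟨V, hV, hvol⟩ := exists_nhds_volume_image_critical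
    (f := fun e => ((f ∘ χ.symm) e).2) (contDiff_snd.contDiffAt.comp _
      (contDiffAt_chart hf.self_of_nhds))
  refine ⟨_, Filter.inter_mem (Filter.inter_mem
    ((continuousAt_extChartAt (I := 𝓘(ℝ, ℂ)) z₀).preimage_mem_nhds hV)
    (extChartAt_source_mem_nhds (I := 𝓘(ℝ, ℂ)) z₀)) hf, measure_mono_null ?_ hvol⟩
  rintro _ ⟨z, ⟨⟨⟨hzV, hzs⟩, hzf⟩, hz0⟩, rfl⟩
  refine ⟨χ z, ⟨hzV, ?_⟩, ?_⟩
  · have h1 : HasMFDerivAt 𝓘(ℝ, ℂ) 𝓘(ℝ, ℝ × ℝ) f (χ.symm (χ z)) (0 : ℂ →L[ℝ] ℝ × ℝ) := by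
      rw [χ.left_inv hzs]
      have := hasMFDerivAt_surfDiff _ (ContMDiffAt.mdifferentiableAt hzf (by simp))
      rwa [show surfDiff 𝓘(ℝ, ℝ × ℝ) f z = 0 from hz0] at this
    have h2 := h1.comp (χ z)
      (mdifferentiableAt_extChartAt_symm' (χ.map_source hzs)).hasMFDerivAt
    have h3 : HasMFDerivAt 𝓘(ℝ, ℂ) 𝓘(ℝ, ℝ × ℝ) (f ∘ χ.symm) (χ z) (0 : ℂ →L[ℝ] ℝ × ℝ) :=
      h2.congr_mfderiv (ContinuousLinearMap.zero_comp _)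
    have h4 := (hasFDerivAt_snd (𝕜 := ℝ) (p := (f ∘ χ.symm) (χ z))).comp (χ z) h3.hasFDerivAt
    rw [ContinuousLinearMap.comp_zero] at h4
    exact h4.fderiv
  · simp [χ.left_inv hzs]

variable {φ : Torus ≃ₘ⟮𝓘(ℝ, Plane), 𝓘(ℝ, Plane)⟯ Torus} {hφ : IsFlatIsometry φ}
  {v : X → MappingTorus (unitCotangentLift φ hφ)}

theorem isClosed_preimage_leaf (hv : ContMDiff 𝓘(ℝ, ℂ) MappingTorus.model ∞ v) (htan : IsTangent v)
    (c : UnitCotangent) : IsClosed (v ⁻¹' leaf hφ c) := by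
  rw [← isOpen_compl_iff, isOpen_iff_mem_nhds]
  intro z₀ hz₀
  obtain ⟨c', t, θ, hc'⟩ := exists_mem_leaf hφ (v z₀)
  obtain ⟨f, -, hf⟩ := exists_leaf_coordinates hv htan hc'
  filter_upwards [hf] with z hz hzc
  exact hz₀ (leaf_subset_of_mem (m := v z) hzc ⟨_, _, hz.2.1⟩ ⟨t, θ, hc'⟩)

open MeasureTheory in
/-- The angles of the critical points on a leaf form a null set. -/
theorem volume_critical_angles [CompactSpace X]
    (hv : ContMDiff 𝓘(ℝ, ℂ) MappingTorus.model ∞ v) (htan : IsTangent v) (c : UnitCotangent) :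
    volume {θ : ℝ | ∃ z ∈ v ⁻¹' leaf hφ c, surfDiff MappingTorus.model v z = 0 ∧
      MappingTorus.angle _ (v z) = (θ : AddCircle (1 : ℝ))} = 0 := by
  have hloc : ∀ z₀ ∈ v ⁻¹' leaf hφ c, ∃ f : X → ℝ × ℝ, ∃ V ∈ 𝓝 z₀,
      volume ((fun z => (f z).2) '' (V ∩ {z | surfDiff 𝓘(ℝ, ℝ × ℝ) f z = 0})) = 0 ∧
      ∀ z ∈ V, v z = MappingTorus.proj (unitCotangentLift φ hφ) (geo (f z).1 c, (f z).2) ∧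
      (surfDiff MappingTorus.model v z = 0 → surfDiff 𝓘(ℝ, ℝ × ℝ) f z = 0) := by
    rintro z₀ ⟨t, θ, hc⟩
    obtain ⟨f, -, hf⟩ := exists_leaf_coordinates hv htan hc
    obtain ⟨V, hV, hvol⟩ := exists_nhds_volume_image_snd (hf.mono fun z hz => hz.1)
    refine ⟨f, _, Filter.inter_mem hV hf, measure_mono_null (image_mono ?_) hvol,
      fun z hz => ⟨hz.2.2.1, hz.2.2.2.1⟩⟩
    exact inter_subset_inter_left _ inter_subset_left
  choose! f V hV hvol hf using hloc
  obtain ⟨s, hs, hcov⟩ := (isClosed_preimage_leaf hv htan c).isCompact.elim_nhds_subcover V hV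
  refine measure_mono_null (t := ⋃ z₀ ∈ s, ⋃ n : ℤ, (fun x => x + (n : ℝ)) ''
    ((fun z => (f z₀ z).2) '' (V z₀ ∩ {z | surfDiff 𝓘(ℝ, ℝ × ℝ) (f z₀) z = 0}))) ?_ ?_
  · rintro θ ⟨z, hz, hcrit, hangle⟩
    obtain ⟨z₀, hz₀, hzV⟩ := mem_iUnion₂.mp (hcov hz)
    obtain ⟨h1, h2⟩ := hf z₀ (hs z₀ hz₀) z hzV
    rw [h1, MappingTorus.angle_proj] at hangle
    obtain ⟨n, hn⟩ := MappingTorus.coe_eq_coe_iff.mp hangle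
    exact mem_iUnion₂.mpr ⟨z₀, hz₀, mem_iUnion.mpr ⟨n, _, ⟨z, ⟨hzV, h2 hcrit⟩, rfl⟩, hn⟩⟩
  · refine (measure_biUnion_null_iff s.countable_toSet).mpr fun z₀ hz₀ => ?_
    rw [measure_iUnion_null_iff]
    intro n
    rw [image_add_right, measure_preimage_add_right]
    exact hvol z₀ (hs z₀ hz₀)

/-- A tangent map from a closed surface to a leaf that returns has zero differential. -/
theorem surfDiff_eq_zero_of_returns [CompactSpace X] (hfix : FixesNoClosedGeodesic φ)
    (hv : ContMDiff 𝓘(ℝ, ℂ) MappingTorus.model ∞ v) (htan : IsTangent v) {c : UnitCotangent}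
    (hc : Returns hφ c) {z₁ : X} (hz₁ : v z₁ ∈ leaf hφ c) :
    surfDiff MappingTorus.model v z₁ = 0 := by
  by_contra hne
  obtain ⟨κ, hκ⟩ := exists_slope hfix hc
  have hopen : ∀ z₀ t₀ θ₀, v z₀ = MappingTorus.proj (unitCotangentLift φ hφ) (geo t₀ c, θ₀) →
      surfDiff MappingTorus.model v z₀ ≠ 0 → ∀ᶠ p in 𝓝 (t₀, θ₀), ∃ z,
        v z = MappingTorus.proj (unitCotangentLift φ hφ) (geo p.1 c, p.2) := by
    intro z₀ t₀ θ₀ h₀ hne₀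
    obtain ⟨f, hf₀, hf⟩ := exists_leaf_coordinates hv htan h₀
    have h1 := nhds_le_map_of_surjective hf.self_of_nhds.1 (hf.self_of_nhds.2.2.2.1 hne₀)
    rw [hf₀] at h1
    filter_upwards [h1 (Filter.image_mem_map hf)] with p hp
    obtain ⟨z, hz, rfl⟩ := hp
    exact ⟨z, hz.2.1⟩
  obtain ⟨θs, hθs, z₂, hz₂, hz₂θ⟩ : ∃ θs : ℝ,
      (¬ ∃ z ∈ v ⁻¹' leaf hφ c, surfDiff MappingTorus.model v z = 0 ∧
        MappingTorus.angle _ (v z) = (θs : AddCircle (1 : ℝ))) ∧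
      ∃ z ∈ v ⁻¹' leaf hφ c, MappingTorus.angle _ (v z) = (θs : AddCircle (1 : ℝ)) := by
    obtain ⟨t₁, θ₁, h₁⟩ := hz₁
    have h2 : ∀ᶠ θ in 𝓝 θ₁, ∃ z,
        v z = MappingTorus.proj (unitCotangentLift φ hφ) (geo t₁ c, θ) :=
      (Continuous.prodMk_right t₁).tendsto θ₁ |>.eventually (hopen z₁ t₁ θ₁ h₁ hne)
    by_contra! hcon
    have h3 : {θ : ℝ | ∃ z ∈ v ⁻¹' leaf hφ c, surfDiff MappingTorus.model v z = 0 ∧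
        MappingTorus.angle _ (v z) = (θ : AddCircle (1 : ℝ))} ∈ 𝓝 θ₁ := by
      filter_upwards [h2] with θ ⟨z, hz⟩
      by_contra hno
      exact hcon θ (by simpa using hno) z ⟨t₁, θ, hz⟩ (by rw [hz]; rfl)
    exact (MeasureTheory.Measure.measure_pos_of_mem_nhds MeasureTheory.volume h3).ne'
      (volume_critical_angles hv htan c)
  let h : X → ℝ := fun z => Classical.epsilon fun r => ∃ t θ,
    v z = MappingTorus.proj (unitCotangentLift φ hφ) (geo t c, θ) ∧ r = t - κ * θ
  have hh : ∀ z t θ, v z = MappingTorus.proj (unitCotangentLift φ hφ) (geo t c, θ) →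
      h z = t - κ * θ := by
    intro z t θ hz
    obtain ⟨t', θ', hz', hr⟩ : ∃ t' θ', v z = MappingTorus.proj (unitCotangentLift φ hφ)
        (geo t' c, θ') ∧ h z = t' - κ * θ' :=
      Classical.epsilon_spec (p := fun r => ∃ t θ, v z = MappingTorus.proj
        (unitCotangentLift φ hφ) (geo t c, θ) ∧ r = t - κ * θ) ⟨_, t, θ, hz, rfl⟩
    obtain ⟨n, hn, hθ⟩ := (proj_eq_proj_iff hφ _ _ _ _).mp (hz'.symm.trans hz)
    have h1 := hκ n (t - t') (geo_injective t' (by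
      rw [← liftPow_geo, hn, geo_geo, add_sub_cancel]))
    rw [hr, ← hθ]
    linear_combination -h1
  have hcont : ContinuousOn h (v ⁻¹' leaf hφ c) := by
    rintro z₀ ⟨t₀, θ₀, h₀⟩
    obtain ⟨f, -, hf⟩ := exists_leaf_coordinates hv htan h₀
    have hfc : ContinuousAt f z₀ := hf.self_of_nhds.1.continuousAt
    have : ContinuousAt (fun z => (f z).1 - κ * (f z).2) z₀ :=
      hfc.fst.sub (continuousAt_const.mul hfc.snd)
    refine (this.congr ?_).continuousWithinAt
    filter_upwards [hf] with z hz
    exact (hh z _ _ hz.2.1).symm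
  have hK : IsCompact (v ⁻¹' leaf hφ c ∩ {z | MappingTorus.angle _ (v z) =
      (θs : AddCircle (1 : ℝ))}) :=
    ((isClosed_preimage_leaf hv htan c).inter (isClosed_singleton.preimage
      ((MappingTorus.continuous_angle _).comp hv.continuous))).isCompact
  obtain ⟨z₃, ⟨hz₃, hz₃θ⟩, hmax⟩ := hK.exists_isMaxOn ⟨z₂, hz₂, hz₂θ⟩
    (hcont.mono inter_subset_left)
  have hne₃ : surfDiff MappingTorus.model v z₃ ≠ 0 := fun h0 => hθs ⟨z₃, hz₃, h0, hz₃θ⟩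
  obtain ⟨t₃, θ₃, h₃⟩ := hz₃
  have h4 : ∀ᶠ t in 𝓝 t₃, ∃ z,
      v z = MappingTorus.proj (unitCotangentLift φ hφ) (geo t c, θ₃) :=
    (Continuous.prodMk_left θ₃).tendsto t₃ |>.eventually (hopen z₃ t₃ θ₃ h₃ hne₃)
  obtain ⟨t₄, ⟨z₄, hz₄⟩, ht₄⟩ :=
    ((h4.filter_mono nhdsWithin_le_nhds).and (self_mem_nhdsWithin (s := Ioi t₃))).exists
  have h5 : h z₄ ≤ h z₃ := hmax ⟨⟨t₄, θ₃, hz₄⟩, by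
    have : MappingTorus.angle _ (v z₃) = (θs : AddCircle (1 : ℝ)) := hz₃θ
    rw [h₃] at this
    change MappingTorus.angle _ (v z₄) = _
    rw [hz₄]
    exact this⟩
  rw [hh z₄ _ _ hz₄, hh z₃ _ _ h₃] at h5
  have : t₃ < t₄ := ht₄
  linarith

/-- The pullback of the Lee form to a closed surface by a tangent map is exact, with a primitive
that is pulled back from the mapping torus. -/
theorem leafPrimitive_spec [CompactSpace X] (hfix : FixesNoClosedGeodesic φ)
    (hv : ContMDiff 𝓘(ℝ, ℂ) MappingTorus.model ∞ v) (htan : IsTangent v) (z₀ : X) :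
    ContMDiffAt 𝓘(ℝ, ℂ) 𝓘(ℝ, ℝ) ∞ (leafPrimitive hφ ∘ v) z₀ ∧
      ∀ w, (MappingTorus.alpha (unitCotangentLift φ hφ)).val (v z₀)
        (surfDiff MappingTorus.model v z₀ w) = surfDiff 𝓘(ℝ, ℝ) (leafPrimitive hφ ∘ v) z₀ w := by
  set c := leafBase hφ (v z₀) with hcdef
  have hmem : v z₀ ∈ leaf hφ c := mem_leaf_leafBase hφ (v z₀)
  obtain ⟨t₀, θ₀, h₀⟩ := id hmem
  obtain ⟨f, -, hf⟩ := exists_leaf_coordinates hv htan h₀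
  have hbase : ∀ᶠ z in 𝓝 z₀, leafBase hφ (v z) = c :=
    hf.mono fun z hz => leafBase_eq ⟨_, _, hz.2.1⟩ hmem
  by_cases hc : Returns hφ c
  · have hev : leafPrimitive hφ ∘ v =ᶠ[𝓝 z₀] fun _ => 0 := by
      filter_upwards [hbase] with z hz
      exact leafPrimitive_of_returns (by rwa [hz])
    have h1 : HasMFDerivAt 𝓘(ℝ, ℂ) 𝓘(ℝ, ℝ) (leafPrimitive hφ ∘ v) z₀ (0 : ℂ →L[ℝ] ℝ) :=
      (hasMFDerivAt_const (0 : ℝ) z₀).congr_of_eventuallyEq hev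
    have h2 : surfDiff 𝓘(ℝ, ℝ) (leafPrimitive hφ ∘ v) z₀ = 0 := h1.mfderiv
    refine ⟨contMDiffAt_const.congr_of_eventuallyEq hev, fun w => ?_⟩
    rw [h2, surfDiff_eq_zero_of_returns hfix hv htan hc hmem]
    exact map_zero _
  · have hev : leafPrimitive hφ ∘ v =ᶠ[𝓝 z₀] fun z => (f z).2 := by
      filter_upwards [hf, hbase] with z hz hzb
      exact leafPrimitive_of_not_returns (by rwa [hzb]) (by rw [hzb]; exact hz.2.1)
    have h0 : HasMFDerivAt 𝓘(ℝ, ℝ × ℝ) 𝓘(ℝ, ℝ) Prod.snd (f z₀) (ContinuousLinearMap.snd ℝ ℝ ℝ) :=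
      hasFDerivAt_snd.hasMFDerivAt
    have h1 := (h0.comp z₀ (hasMFDerivAt_surfDiff _
      (hf.self_of_nhds.1.mdifferentiableAt (by simp)))).congr_of_eventuallyEq hev
    have h2 : surfDiff 𝓘(ℝ, ℝ) (leafPrimitive hφ ∘ v) z₀ =
        (ContinuousLinearMap.snd ℝ ℝ ℝ).comp (surfDiff 𝓘(ℝ, ℝ × ℝ) f z₀) := h1.mfderiv
    have h3 : ContMDiff 𝓘(ℝ, ℝ × ℝ) 𝓘(ℝ, ℝ) ∞ (Prod.snd : ℝ × ℝ → ℝ) := contDiff_snd.contMDiff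
    refine ⟨((h3 (f z₀)).comp z₀ hf.self_of_nhds.1).congr_of_eventuallyEq hev, fun w => ?_⟩
    rw [h2]
    exact hf.self_of_nhds.2.2.2.2 w

end Surface

theorem isManifold_real_of_complex (X : Type*) [TopologicalSpace X] [ChartedSpace ℂ X]
    [IsManifold 𝓘(ℂ) ω X] : IsManifold 𝓘(ℝ, ℂ) ∞ X := by
  apply isManifold_of_contDiffOn
  intro e e' he he'
  have h := (contDiffGroupoid ω 𝓘(ℂ)).compatible he he'
  have h1 : ContDiffOn ℂ ω (𝓘(ℂ) ∘ (e.symm ≫ₕ e') ∘ 𝓘(ℂ).symm)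
    (𝓘(ℂ).symm ⁻¹' (e.symm ≫ₕ e').source ∩ range 𝓘(ℂ)) := h.1
  exact (h1.restrict_scalars ℝ).of_le le_top

theorem not_hasReebTwoCurve {φ : Torus ≃ₘ⟮𝓘(ℝ, Plane), 𝓘(ℝ, Plane)⟯ Torus}
    (hφ : IsFlatIsometry φ) (hfix : FixesNoClosedGeodesic φ) :
    ¬ HasReebTwoCurve (MappingTorus.lam (unitCotangentLift φ hφ) liouville)
      (MappingTorus.alpha (unitCotangentLift φ hφ)) := by
  rintro ⟨S, u, hu⟩
  have := isManifold_real_of_complex S.Normalization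
  have htan : IsTangent (u ∘ S.quotientMap) := by
    intro z hz
    refine hu.tangent z hz ?_
    obtain ⟨y, hy⟩ := surjective_param (unitCotangentLift φ hφ) ((u ∘ S.quotientMap) z)
    rw [← hy]
    exact finrank_distribution (preserves_liouville hφ) y
  refine hu.class_ne_zero ⟨leafPrimitive hφ ∘ u,
    fun z => (leafPrimitive_spec hfix hu.smooth htan z).1, fun z => ?_⟩
  exact ContinuousLinearMap.ext (leafPrimitive_spec hfix hu.smooth htan z).2

theorem not_naiveLcsWeinstein : ¬ NaiveLcsWeinstein := by
  intro h
  have hli : LinearIndependent ℚ ![(1 : ℝ), (!₂[√2, √3] : Plane) 0, (!₂[√2, √3] : Plane) 1] := by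
    simpa using linearIndependent_sqrt_two_three
  have hφ := Torus.isFlatIsometry_rotation !₂[√2, √3]
  have hfix := Torus.fixesNoClosedGeodesic_rotation hli
  exact not_hasReebTwoCurve hφ hfix (h _ _ _ _ _ _ (isExactLcs (preserves_liouville hφ)))

end LCS

end

theorem theorem2p10 :
    -- Mapping tori of lifts of isometries without invariant closed geodesics have no Reeb 2-curves.
    (∀ (φ : LCS.Torus ≃ₘ⟮𝓘(ℝ, LCS.Plane), 𝓘(ℝ, LCS.Plane)⟯ LCS.Torus)
      (hφ : LCS.IsFlatIsometry φ), LCS.FixesNoClosedGeodesic φ →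
        T2Space (LCS.MappingTorus (LCS.unitCotangentLift φ hφ)) ∧
        CompactSpace (LCS.MappingTorus (LCS.unitCotangentLift φ hφ)) ∧
        ConnectedSpace (LCS.MappingTorus (LCS.unitCotangentLift φ hφ)) ∧
        LCS.IsExactLcs
          (LCS.MappingTorus.lam (LCS.unitCotangentLift φ hφ) LCS.liouville)
          (LCS.MappingTorus.alpha (LCS.unitCotangentLift φ hφ)) ∧
        ¬ LCS.HasReebTwoCurve
          (LCS.MappingTorus.lam (LCS.unitCotangentLift φ hφ) LCS.liouville)
          (LCS.MappingTorus.alpha (LCS.unitCotangentLift φ hφ))) ∧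
    -- Irrational rotations are such isometries.
    (∀ a : LCS.Plane, LinearIndependent ℚ ![(1 : ℝ), a 0, a 1] →
      ∃ φ : LCS.Torus ≃ₘ⟮𝓘(ℝ, LCS.Plane), 𝓘(ℝ, LCS.Plane)⟯ LCS.Torus,
        (∀ x, φ (LCS.Torus.proj x) = LCS.Torus.proj (x + a)) ∧
        LCS.IsFlatIsometry φ ∧ LCS.FixesNoClosedGeodesic φ) ∧
    -- The naive lcs analogue of the Weinstein conjecture is false.
    ¬ LCS.NaiveLcsWeinstein := by
  refine ⟨fun φ hφ hfix => ?_, fun a ha => ?_, LCS.not_naiveLcsWeinstein⟩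
  · exact ⟨inferInstance, inferInstance, inferInstance,
      LCS.isExactLcs (LCS.preserves_liouville hφ), LCS.not_hasReebTwoCurve hφ hfix⟩
  · exact ⟨LCS.Torus.rotation a, fun _ => rfl, LCS.Torus.isFlatIsometry_rotation a,
      LCS.Torus.fixesNoClosedGeodesic_rotation ha⟩
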